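/- Let $M(x)=\sum_{n\le x}\mu(n)$ be the summatory function of the Möbius function and let $\zeta$ be the Riemann zeta function. For $g$ positive, write $f(x)=\Omega_\pm(g(x))$ if $\limsup_{x\to\infty} f(x)/g(x)>0$ and $\liminf_{x\to\infty} f(x)/g(x)<0$. Then, unconditionally: (i) for every real $\kappa<3/2$, $$\int_1^x \frac{M(u)}{u^{\kappa}}\,du=\Omega_\pm\bigl(x^{3/2-\kappa}\bigr);$$ (ii) for $\kappa=3/2$, $$\int_1^x \frac{M(u)}{u^{3/2}}\,du-\frac{2}{\zeta(1/2)}=\Omega_\pm(1).$$ In particular, $$\int_1^\infty \frac{|M(x)|}{x^{3/2}}\,dx=\infty.$$ -/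

import Mathlib

/-- The summatory function `M(x) = ∑_{n ≤ x} μ(n)` of the Möbius function. -/
noncomputable def mertensM (x : ℝ) : ℝ :=
  ∑ n ∈ Finset.Icc 1 ⌊x⌋₊, ((ArithmeticFunction.moebius n : ℤ) : ℝ)

/-- `f = Ω₊(g)` as `x → ∞` (for a positive comparison function `g`, this says
`limsup f / g > 0`): some `c > 0` has `f x > c * g x` for arbitrarily large `x`. -/
def IsBigOmegaPlus (f g : ℝ → ℝ) : Prop :=
  ∃ c : ℝ, 0 < c ∧ ∃ᶠ x in Filter.atTop, c * g x < f x

/-- `f = Ω₋(g)` as `x → ∞` (for a positive comparison function `g`, this says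
`liminf f / g < 0`): some `c > 0` has `f x < -c * g x` for arbitrarily large `x`. -/
def IsBigOmegaMinus (f g : ℝ → ℝ) : Prop :=
  ∃ c : ℝ, 0 < c ∧ ∃ᶠ x in Filter.atTop, f x < -(c * g x)

/-- `f = Ω±(g)` as `x → ∞`: both `f = Ω₊(g)` and `f = Ω₋(g)`. -/
def IsBigOmegaPlusMinus (f g : ℝ → ℝ) : Prop :=
  IsBigOmegaPlus f g ∧ IsBigOmegaMinus f g

/-- The real number `2 / ζ(1/2)`, as the real part of a complex number that is real
(see `twoDivZetaHalf_eq`). -/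
noncomputable def twoDivZetaHalf : ℝ := (2 / riemannZeta (1 / 2)).re

/-- Taking the real part in `twoDivZetaHalf` loses nothing. -/
theorem twoDivZetaHalf_eq : (twoDivZetaHalf : ℂ) = 2 / riemannZeta (1 / 2) := by
  unfold twoDivZetaHalf
  refine Complex.conj_eq_iff_re.mp ?_
  have h2 : (starRingEnd ℂ) 2 = 2 := map_ofNat _ 2
  rw [map_div₀, ← riemannZeta_conj, map_div₀, map_one, h2]

/-- The mean values of `M` below are integrals of integrable functions. -/
theorem intervalIntegrable_mertensM_div_rpow (κ x : ℝ) (hx : 1 ≤ x) :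
    IntervalIntegrable (fun u : ℝ => mertensM u / u ^ κ) MeasureTheory.volume 1 x := by
  rw [intervalIntegrable_iff_integrableOn_Icc_of_le hx]
  have hg : ContinuousOn (fun u : ℝ => (u ^ κ)⁻¹) (Set.Icc 1 x) := fun u hu => by
    have hu0 : 0 < u := lt_of_lt_of_le one_pos hu.1
    exact ((Real.continuousAt_rpow_const u κ (Or.inl hu0.ne')).inv₀
      (Real.rpow_pos_of_pos hu0 κ).ne').continuousWithinAt
  have h := integrableOn_mul_sum_Icc (m := 1)
    (fun n : ℕ => ((ArithmeticFunction.moebius n : ℤ) : ℝ)) zero_le_one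
    (hg.integrableOn_Icc (μ := MeasureTheory.volume))
  refine h.congr_fun (fun u _ => ?_) measurableSet_Icc
  simp only [mertensM, div_eq_mul_inv, mul_comm]

/-! Put F(x) = ∫₁ˣ M(u) u^{-κ} du. Its Mellin transform is 1/(w s ζ(s)) with s = w + κ - 1. Suppose
τ(F - c) ≥ -ε x^{3/2-κ} eventually, the sign of τ selecting the direction. Adding ε x^{3/2-κ} and a
harmless K/x gives a function that is nonnegative on (1, ∞), whose transform continues along the
real axis down to 3/2 - κ because (s - 1)ζ(s) has no real zero s > 0. By Landau's theorem
(`Ioi_subset_integrableExpSet`) the transform converges, hence is holomorphic, for Re w > 3/2 - κ,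
that is for Re s > 1/2.

Let ρ be a zeta zero with Re ρ ≥ 1/2 (`exists_riemannZeta₁_eq_zero`). If Re ρ > 1/2, holomorphy is
already violated. If Re ρ = 1/2, positivity bounds the transform at w by its value at Re w;
approaching ρ + 1 - κ horizontally, the singularity there can be no stronger than the one at 3/2 -
κ. The latter has residue only ε (`tendsto_mul_oscillationTransform`): F - c contributes no pole
there, since for κ = 3/2 the constant 2/ζ(1/2) cancels the pole at w = 0. A small ε is therefore
impossible. Neither RH nor simplicity of zeros is used.

The zero exists because a zero-free ξ would, by its growth, be the exponential of an affine
function, hence constant by ξ(1 - s) = ξ(s); but ξ(0) = 1 and ξ(2) = π/3. The divergent integral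
follows from κ = 3/2: absolute convergence would give F a limit. -/

/-! ### Landau's theorem for positive measures -/

theorem AnalyticAt.along_ofReal {f : ℂ → ℂ} {t : ℝ} (h : AnalyticAt ℂ f t) :
    AnalyticAt ℝ (fun x : ℝ => f x) t :=
  (h.restrictScalars (𝕜 := ℝ)).comp_of_eq (Complex.ofRealCLM.analyticAt t) rfl

open MeasureTheory ProbabilityTheory in
-- As X ≤ 0, exp(tX) decreases in t. Hence the set of convergence is an upper ray, and its infimum
-- plays the role of the abscissa of convergence.
theorem integrableExpSet_mono_of_nonpos {Ω : Type*} [MeasurableSpace Ω] {μ : Measure Ω}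
    {X : Ω → ℝ} (hXm : AEMeasurable X μ) (hX : ∀ᵐ ω ∂μ, X ω ≤ 0) {s t : ℝ} (hst : s ≤ t)
    (hs : s ∈ integrableExpSet X μ) : t ∈ integrableExpSet X μ := by
  refine Integrable.mono' (g := fun ω => Real.exp (s * X ω)) hs ?_ ?_
  · exact (Real.measurable_exp.comp_aemeasurable (hXm.const_mul t)).aestronglyMeasurable
  · filter_upwards [hX] with ω hω
    rw [Real.norm_eq_abs, abs_of_pos (Real.exp_pos _)]
    exact Real.exp_le_exp.mpr (mul_le_mul_of_nonpos_right hst hω)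

open MeasureTheory ProbabilityTheory Filter Topology in
/-- If `complexMGF X μ` with `X ≤ 0` continues holomorphically to a neighbourhood of `c`, and
exponential moments exist to the right of `c`, then they exist slightly to the left of `c`. -/
theorem exists_lt_mem_integrableExpSet {Ω : Type*} [MeasurableSpace Ω] {μ : Measure Ω}
    {X : Ω → ℝ} (hXm : AEMeasurable X μ) (hX : ∀ᵐ ω ∂μ, X ω ≤ 0) {c r : ℝ} (hr : 0 < r)
    (hc : Set.Ioi c ⊆ integrableExpSet X μ) {G : ℂ → ℂ}
    (hG : DifferentiableOn ℂ G (Metric.ball (c : ℂ) r))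
    (hGX : ∀ t : ℝ, c < t → complexMGF X μ t = G t) :
    ∃ t < c, t ∈ integrableExpSet X μ := by
  have hint : Set.Ioi c ⊆ interior (integrableExpSet X μ) := isOpen_Ioi.subset_interior_iff.mpr hc
  -- The centre a lies in the region of convergence, and the disc of radius 2r/3 about it stays
  -- inside the given disc about c while reaching points to the left of c.
  set a : ℝ := c + r / 3 with ha
  have hac : c < a := by linarith
  have haint : ((a : ℂ)).re ∈ interior (integrableExpSet X μ) := by
    rw [Complex.ofReal_re]; exact hint hac
  have hball : Metric.ball (a : ℂ) (2 * r / 3) ⊆ Metric.ball (c : ℂ) r := by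
    refine Metric.ball_subset_ball' ?_
    rw [Complex.dist_of_im_eq (by simp)]
    simp only [Complex.ofReal_re, Real.dist_eq]
    rw [abs_of_pos (by linarith)]
    linarith
  -- The two functions are known to agree only at real points; the identity theorem gives a full
  -- neighbourhood of a.
  have hev : complexMGF X μ =ᶠ[𝓝 (a : ℂ)] G := by
    refine (AnalyticAt.frequently_eq_iff_eventually_eq (analyticAt_complexMGF haint)
      ((hG.mono hball).analyticAt (Metric.ball_mem_nhds _ (by positivity)))).mp ?_
    have hm : Tendsto (fun t : ℝ => (t : ℂ)) (𝓝[>] a) (𝓝[≠] (a : ℂ)) := by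
      refine tendsto_nhdsWithin_iff.mpr
        ⟨(Complex.continuous_ofReal.tendsto a).mono_left nhdsWithin_le_nhds, ?_⟩
      filter_upwards [self_mem_nhdsWithin] with t ht
      exact fun h => (ne_of_gt ht) (Complex.ofReal_injective h)
    refine hm.frequently (Eventually.frequently ?_)
    filter_upwards [self_mem_nhdsWithin] with t ht
    exact hGX t (hac.trans ht)
  have hderiv : ∀ n : ℕ, iteratedDeriv n G a = μ[fun ω ↦ (X ω : ℂ) ^ n * Complex.exp (a * X ω)] :=
    fun n => by rw [← iteratedDeriv_complexMGF haint n, hev.iteratedDeriv_eq n]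
  -- This is t = c - r/6, to the left of c.
  set t : ℝ := a - r / 2 with ht
  have htball : (t : ℂ) ∈ Metric.ball (a : ℂ) (2 * r / 3) := by
    rw [Metric.mem_ball, Complex.dist_of_im_eq (by simp)]
    simp only [Complex.ofReal_re, Real.dist_eq]
    rw [abs_of_neg (by linarith)]
    linarith
  have hsum := (Complex.hasSum_taylorSeries_on_ball (hG.mono hball) htball).summable.norm
  have hinti : ∀ n : ℕ, Integrable (fun ω => |X ω| ^ n * Real.exp (a * X ω)) μ := fun n =>
    integrable_pow_abs_mul_exp_of_mem_interior_integrableExpSet (by simpa using haint) n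
  -- Since X ≤ 0, the n-th derivative at a is (-1)ⁿ times a nonnegative integral, so absolute
  -- convergence of the Taylor series at t is convergence of a series of integrals of nonnegative
  -- functions. Tonelli then sums it to the integral of exp(tX).
  have hnorm : ∀ n : ℕ, ‖((n.factorial : ℂ)⁻¹ • ((t : ℂ) - a) ^ n • iteratedDeriv n G a)‖ =
      ∫ ω, (r / 2 * |X ω|) ^ n / n.factorial * Real.exp (a * X ω) ∂μ := by
    intro n
    have h1 : ∫ ω, (X ω : ℂ) ^ n * Complex.exp (a * X ω) ∂μ =
        ((-1) ^ n : ℂ) * ((∫ ω, |X ω| ^ n * Real.exp (a * X ω) ∂μ : ℝ) : ℂ) := by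
      rw [← integral_complex_ofReal, ← integral_const_mul]
      refine integral_congr_ae ?_
      filter_upwards [hX] with ω hω
      rw [abs_of_nonpos hω]
      push_cast
      rw [← mul_assoc, ← mul_pow]
      simp
    have h2 : (0 : ℝ) ≤ ∫ ω, |X ω| ^ n * Real.exp (a * X ω) ∂μ :=
      integral_nonneg fun ω => by positivity
    have h3 : ‖((t : ℂ) - a)‖ = r / 2 := by
      rw [← Complex.ofReal_sub, Complex.norm_real, Real.norm_eq_abs, abs_of_neg] <;> linarith
    rw [hderiv, h1]
    simp only [norm_smul, norm_mul, norm_pow, norm_neg, norm_one, one_pow, one_mul, norm_inv,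
      RCLike.norm_natCast, h3, Complex.norm_real, Real.norm_eq_abs, abs_of_nonneg h2]
    rw [← integral_const_mul, ← integral_const_mul]
    congr 1 with ω
    rw [mul_pow]
    ring
  simp_rw [hnorm] at hsum
  refine ⟨t, by linarith, ?_⟩
  have hmeas : AEStronglyMeasurable (fun ω => Real.exp (t * X ω)) μ :=
    (Real.measurable_exp.comp_aemeasurable (hXm.const_mul t)).aestronglyMeasurable
  refine ⟨hmeas, ?_⟩
  rw [hasFiniteIntegral_iff_ofReal (ae_of_all _ fun ω => (Real.exp_pos _).le)]
  have hterm : ∀ᵐ ω ∂μ, ENNReal.ofReal (Real.exp (t * X ω)) =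
      ∑' n : ℕ, ENNReal.ofReal ((r / 2 * |X ω|) ^ n / n.factorial * Real.exp (a * X ω)) := by
    filter_upwards [hX] with ω hω
    have hs := (NormedSpace.expSeries_div_hasSum_exp (𝔸 := ℝ) (r / 2 * |X ω|)).mul_right
      (Real.exp (a * X ω))
    rw [← ENNReal.ofReal_tsum_of_nonneg (fun n => by positivity) hs.summable, hs.tsum_eq,
      ← Real.exp_eq_exp_ℝ, ← Real.exp_add, abs_of_nonpos hω, ht]
    congr 2
    ring
  rw [lintegral_congr_ae hterm, lintegral_tsum]
  · have : ∀ n : ℕ, ∫⁻ ω, ENNReal.ofReal ((r / 2 * |X ω|) ^ n / n.factorial *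
        Real.exp (a * X ω)) ∂μ =
        ENNReal.ofReal (∫ ω, (r / 2 * |X ω|) ^ n / n.factorial * Real.exp (a * X ω) ∂μ) := by
      intro n
      rw [ofReal_integral_eq_lintegral_ofReal]
      · refine ((hinti n).const_mul ((r / 2) ^ n / n.factorial)).congr (ae_of_all _ fun ω => ?_)
        simp only [mul_pow]
        ring
      · exact ae_of_all _ fun ω => by positivity
    simp_rw [this]
    rw [← ENNReal.ofReal_tsum_of_nonneg _ hsum]
    · exact ENNReal.ofReal_lt_top
    · exact fun n => integral_nonneg fun ω => by positivity
  · exact fun n => by fun_prop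

open MeasureTheory ProbabilityTheory Filter Topology in
/-- **Landau's theorem** on the real singularity of Laplace transforms of positive measures. -/
theorem Ioi_subset_integrableExpSet {Ω : Type*} [MeasurableSpace Ω] {μ : Measure Ω}
    {X : Ω → ℝ} (hXm : AEMeasurable X μ) (hX : ∀ᵐ ω ∂μ, X ω ≤ 0) {a b : ℝ} {G : ℂ → ℂ}
    (hG : ∀ t : ℝ, a < t → AnalyticAt ℂ G t) (hb : Set.Ioi b ⊆ integrableExpSet X μ)
    (hGX : ∀ t : ℝ, b < t → complexMGF X μ t = G t) :
    Set.Ioi a ⊆ integrableExpSet X μ := by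
  intro σ hσ
  by_contra hn
  set S := integrableExpSet X μ
  have hlb : σ ∈ lowerBounds S := fun s hs => by
    by_contra hlt
    exact hn (integrableExpSet_mono_of_nonpos hXm hX (not_le.mp hlt).le hs)
  have hne : S.Nonempty := ⟨b + 1, hb (by simp)⟩
  have hac : a < sInf S := lt_of_lt_of_le hσ (le_csInf hne hlb)
  have hc : Set.Ioi (sInf S) ⊆ S := fun t ht => by
    obtain ⟨s, hs, hst⟩ := exists_lt_of_csInf_lt hne ht
    exact integrableExpSet_mono_of_nonpos hXm hX hst.le hs
  have hint : Set.Ioi (sInf S) ⊆ interior S := isOpen_Ioi.subset_interior_iff.mpr hc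
  -- `G` is analytic only near the real ray, so the continuation is carried out along that ray by
  -- the real-analytic identity theorem.
  have heq : Set.EqOn (fun t : ℝ => complexMGF X μ t) (fun t : ℝ => G t) (Set.Ioi (sInf S)) := by
    refine AnalyticOnNhd.eqOn_of_preconnected_of_eventuallyEq
      (z₀ := max b (sInf S) + 1) (fun t ht => (analyticAt_complexMGF ?_).along_ofReal)
      (fun t ht => (hG t (hac.trans ht)).along_ofReal) isPreconnected_Ioi ?_ ?_
    · rw [Complex.ofReal_re]; exact hint ht
    · exact lt_of_le_of_lt (le_max_right b _) (lt_add_one _)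
    · filter_upwards [Ioi_mem_nhds (lt_add_one (max b (sInf S)))] with t ht
      exact hGX t (lt_of_le_of_lt (le_max_left _ _) ht)
  obtain ⟨r, hr, hrball⟩ := Metric.eventually_nhds_iff_ball.mp (hG _ hac).eventually_analyticAt
  obtain ⟨t, htc, htS⟩ := exists_lt_mem_integrableExpSet hXm hX hr hc
    (fun z hz => (hrball z hz).differentiableAt.differentiableWithinAt) heq
  exact absurd (csInf_le ⟨σ, hlb⟩ htS) (not_le.mpr htc)

/-! ### The function (s - 1)ζ(s) on Re s > 0 -/

open MeasureTheory Filter Topology Complex in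
-- The truncated fractional part vanishes near 0 and is bounded at infinity, so only the upper end
-- restricts s.
theorem differentiableAt_mellin_fract {s : ℂ} (hs : s.re < 0) :
    DifferentiableAt ℂ (mellin ((Set.Ioi (1 : ℝ)).indicator fun t => ((Int.fract t : ℝ) : ℂ))) s := by
  refine mellin_differentiableAt_of_isBigO_rpow (a := 0) (b := s.re - 1) ?_ ?_ hs ?_ (by linarith)
  · have hm : Measurable ((Set.Ioi (1 : ℝ)).indicator fun t => ((Int.fract t : ℝ) : ℂ)) :=
      (measurable_ofReal.comp measurable_fract).indicator measurableSet_Ioi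
    refine ((locallyIntegrable_const (1 : ℝ)).mono hm.aestronglyMeasurable
      (ae_of_all _ fun t => ?_)).locallyIntegrableOn _
    refine (norm_indicator_le_norm_self _ _).trans ?_
    rw [norm_real, Real.norm_eq_abs, abs_of_nonneg (Int.fract_nonneg t), norm_one]
    exact (Int.fract_lt_one t).le
  · refine Asymptotics.IsBigO.of_bound 1 (Eventually.of_forall fun t => ?_)
    refine (norm_indicator_le_norm_self _ _).trans ?_
    rw [norm_real, Real.norm_eq_abs, abs_of_nonneg (Int.fract_nonneg t)]
    simpa using (Int.fract_lt_one t).le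
  · refine Asymptotics.IsBigO.of_bound 1 ?_
    filter_upwards [Ioo_mem_nhdsGT zero_lt_one] with t ht
    rw [Set.indicator_of_notMem (by simpa using ht.2.le), norm_zero]
    positivity

theorem mellin_fract_neg (s : ℂ) :
    mellin ((Set.Ioi (1 : ℝ)).indicator fun t => ((Int.fract t : ℝ) : ℂ)) (-s) =
      ∫ t in Set.Ioi (1 : ℝ), ((Int.fract t : ℝ) : ℂ) * (t : ℂ) ^ (-(s + 1)) := by
  rw [mellin]
  have h : ∀ t : ℝ, (t : ℂ) ^ (-s - 1) • (Set.Ioi (1 : ℝ)).indicator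
      (fun t => ((Int.fract t : ℝ) : ℂ)) t = (Set.Ioi (1 : ℝ)).indicator
      (fun t => ((Int.fract t : ℝ) : ℂ) * (t : ℂ) ^ (-(s + 1))) t := fun t => by
    by_cases ht : t ∈ Set.Ioi (1 : ℝ)
    · rw [Set.indicator_of_mem ht, Set.indicator_of_mem ht, smul_eq_mul, mul_comm]
      ring_nf
    · rw [Set.indicator_of_notMem ht, Set.indicator_of_notMem ht, smul_zero]
  simp_rw [h]
  rw [MeasureTheory.setIntegral_indicator measurableSet_Ioi,
    Set.inter_eq_right.mpr (Set.Ioi_subset_Ioi zero_le_one)]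

open MeasureTheory Complex in
theorem integrableOn_fract_mul_cpow {s : ℂ} (hs : 0 < s.re) :
    IntegrableOn (fun t : ℝ => ((Int.fract t : ℝ) : ℂ) * (t : ℂ) ^ (-(s + 1))) (Set.Ioi 1) := by
  refine (integrableOn_Ioi_cpow_of_lt (a := -(s + 1)) (by simp; linarith) one_pos).bdd_mul (c := 1)
    (measurable_ofReal.comp measurable_fract).aestronglyMeasurable (ae_of_all _ fun t => ?_)
  rw [norm_real, Real.norm_eq_abs, abs_of_nonneg (Int.fract_nonneg t)]
  exact (Int.fract_lt_one t).le

open MeasureTheory Complex in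
-- Partial summation of ∑ n^{-s}, with ⌊t⌋ split as t minus its fractional part.
theorem riemannZeta₁_eq_of_one_lt_re {s : ℂ} (hs : 1 < s.re) :
    riemannZeta₁ s = s - s * (s - 1) *
      ∫ t in Set.Ioi (1 : ℝ), ((Int.fract t : ℝ) : ℂ) * (t : ℂ) ^ (-(s + 1)) := by
  have hs1 : s ≠ 1 := fun h => by simp [h] at hs
  have hs0 : s - 1 ≠ 0 := sub_ne_zero.mpr hs1
  have h1 : riemannZeta s = s * ∫ t in Set.Ioi (1 : ℝ),
      (∑ k ∈ Finset.Icc 1 ⌊t⌋₊, (1 : ℕ → ℂ) k) * (t : ℂ) ^ (-(s + 1)) := by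
    rw [← LSeries_eq_mul_integral' 1 zero_le_one hs, LSeries_one_eq_riemannZeta hs]
    refine Asymptotics.IsBigO.of_bound 1 (Filter.Eventually.of_forall fun n => ?_)
    simp
  have h2 : ∫ t in Set.Ioi (1 : ℝ), (∑ k ∈ Finset.Icc 1 ⌊t⌋₊, (1 : ℕ → ℂ) k) *
      (t : ℂ) ^ (-(s + 1)) = (∫ t in Set.Ioi (1 : ℝ), (t : ℂ) ^ (-s)) -
      ∫ t in Set.Ioi (1 : ℝ), ((Int.fract t : ℝ) : ℂ) * (t : ℂ) ^ (-(s + 1)) := by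
    rw [← integral_sub (integrableOn_Ioi_cpow_of_lt (by simpa using hs) one_pos)
      (integrableOn_fract_mul_cpow (by linarith))]
    refine setIntegral_congr_fun measurableSet_Ioi fun t ht => ?_
    have ht0 : (0 : ℝ) < t := zero_lt_one.trans ht
    have h3 : (t : ℂ) ^ (-s) = t * (t : ℂ) ^ (-(s + 1)) := by
      rw [show -s = -(s + 1) + 1 by ring, cpow_add _ _ (ofReal_ne_zero.mpr ht0.ne'), cpow_one,
        mul_comm]
    have h4 : ((⌊t⌋₊ : ℝ) : ℂ) = t - (Int.fract t : ℝ) := by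
      rw [← ofReal_sub, Int.self_sub_fract, natCast_floor_eq_intCast_floor ht0.le]
    simp only [Pi.one_apply, Finset.sum_const, Nat.card_Icc, add_tsub_cancel_right, nsmul_eq_mul,
      mul_one]
    rw [h3, ← sub_mul, ← h4, ofReal_natCast]
  rw [integral_Ioi_cpow_of_lt (by simpa using hs) one_pos] at h2
  have h5 := riemannZeta_eq_inv_sub_mul hs1
  rw [h1, h2, ofReal_one, one_cpow] at h5
  have h6 : -s + 1 ≠ 0 := by rw [neg_add_eq_sub]; exact sub_ne_zero.mpr hs1.symm
  generalize ∫ t in Set.Ioi (1 : ℝ), ((Int.fract t : ℝ) : ℂ) * (t : ℂ) ^ (-(s + 1)) = J at *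
  have h7 : riemannZeta₁ s = (s - 1) * (s * (-1 / (-s + 1) - J)) := by
    rw [h5]; field_simp
  rw [h7, show -s + 1 = -(s - 1) by ring, neg_div_neg_eq]
  field_simp

open Complex Filter Topology in
theorem riemannZeta₁_eq_of_re_pos {s : ℂ} (hs : 0 < s.re) :
    riemannZeta₁ s = s - s * (s - 1) *
      ∫ t in Set.Ioi (1 : ℝ), ((Int.fract t : ℝ) : ℂ) * (t : ℂ) ^ (-(s + 1)) := by
  simp_rw [← mellin_fract_neg]
  have hopen : IsOpen {z : ℂ | 0 < z.re} := isOpen_lt continuous_const continuous_re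
  refine AnalyticOnNhd.eqOn_of_preconnected_of_eventuallyEq (U := {z : ℂ | 0 < z.re}) (z₀ := 2)
    (f := riemannZeta₁) (g := fun s => s - s * (s - 1) *
      mellin ((Set.Ioi (1 : ℝ)).indicator fun t => ((Int.fract t : ℝ) : ℂ)) (-s))
    (differentiable_riemannZeta₁.differentiableOn.analyticOnNhd hopen)
    (DifferentiableOn.analyticOnNhd (fun z hz => DifferentiableAt.differentiableWithinAt ?_) hopen)
    (convex_halfSpace_re_gt 0).isPreconnected (by simp) ?_ hs
  · have h1 : DifferentiableAt ℂ (fun s => mellin ((Set.Ioi (1 : ℝ)).indicator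
        fun t => ((Int.fract t : ℝ) : ℂ)) (-s)) z :=
      (differentiableAt_mellin_fract (s := -z) (by simpa using hz)).fun_comp' z
        differentiableAt_id.neg
    fun_prop
  · filter_upwards [(isOpen_lt continuous_const continuous_re).mem_nhds
      (show (1 : ℝ) < (2 : ℂ).re by simp)] with z hz
    rw [mellin_fract_neg]
    exact riemannZeta₁_eq_of_one_lt_re hz

open Complex in
/-- `(s - 1) * ζ(s)` has no zeros on the positive real axis. -/
theorem riemannZeta₁_ofReal_ne_zero {σ : ℝ} (hσ : 0 < σ) : riemannZeta₁ (σ : ℂ) ≠ 0 := by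
  rcases lt_trichotomy σ 1 with h | rfl | h
  · have h1 : ∫ t in Set.Ioi (1 : ℝ), ((Int.fract t : ℝ) : ℂ) * (t : ℂ) ^ (-((σ : ℂ) + 1)) =
        ((∫ t in Set.Ioi (1 : ℝ), Int.fract t * t ^ (-(σ + 1)) : ℝ) : ℂ) := by
      rw [← integral_complex_ofReal]
      refine MeasureTheory.setIntegral_congr_fun measurableSet_Ioi fun t ht => ?_
      rw [ofReal_mul, ofReal_cpow (zero_lt_one.trans ht).le]
      push_cast
      rfl
    have h2 : 0 ≤ ∫ t in Set.Ioi (1 : ℝ), Int.fract t * t ^ (-(σ + 1)) :=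
      MeasureTheory.setIntegral_nonneg measurableSet_Ioi fun t ht =>
        mul_nonneg (Int.fract_nonneg t) (Real.rpow_nonneg (zero_lt_one.trans ht).le _)
    rw [riemannZeta₁_eq_of_re_pos (by simpa using hσ), h1]
    norm_cast
    -- For 0 < σ < 1 the formula reads σ + σ(1 - σ) · (a nonnegative integral), which is positive.
    have := mul_nonneg (mul_nonneg hσ.le (sub_nonneg.mpr h.le)) h2
    nlinarith
  · simp
  · intro h0
    have h1 : (σ : ℂ) ≠ 1 := by exact_mod_cast h.ne'
    refine riemannZeta_ne_zero_of_one_lt_re (s := σ) (by simpa using h) ?_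
    rw [riemannZeta_eq_inv_sub_mul h1, h0, mul_zero]

/-! ### Entire functions of restricted growth -/

/-- A zero-free entire function is the exponential of an entire function. -/
theorem exists_eq_cexp_of_forall_ne_zero {f : ℂ → ℂ} (hf : Differentiable ℂ f) (h0 : ∀ z, f z ≠ 0) :
    ∃ g : ℂ → ℂ, Differentiable ℂ g ∧ ∀ z, f z = Complex.exp (g z) := by
  have hd : Differentiable ℂ (fun z => deriv f z / f z) := fun z =>
    (hf.deriv z).div (hf z) (h0 z)
  obtain ⟨g, hg0, hg⟩ := hd.isExactOn_univ.with_val_at 0 (Complex.log (f 0))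
  have hg' : ∀ z, HasDerivAt g (deriv f z / f z) z := fun z => hg z (Set.mem_univ z)
  refine ⟨g, fun z => (hg' z).differentiableAt, fun z => ?_⟩
  have hq : ∀ w, HasDerivAt (fun z => f z * Complex.exp (-g z)) 0 w := fun w => by
    refine ((hf w).hasDerivAt.mul (hg' w).neg.cexp).congr_deriv ?_
    field_simp [h0 w]
    ring
  have hc := is_const_of_deriv_eq_zero (fun w => (hq w).differentiableAt)
    (fun w => (hq w).deriv) z 0
  simp only [hg0, Complex.exp_neg, Complex.exp_log (h0 0), mul_inv_cancel₀ (h0 0)] at hc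
  exact (mul_inv_eq_one₀ (Complex.exp_ne_zero _)).mp hc

open Filter Topology in
/-- An entire function whose real part is at most `o(|z|²)` is affine. -/
theorem eq_affine_of_re_le {g : ℂ → ℂ} (hg : Differentiable ℂ g)
    (h : ∀ ε > (0 : ℝ), ∀ᶠ R : ℝ in atTop, ∀ z, ‖z‖ ≤ R → (g z).re ≤ ε * R ^ 2) :
    ∃ a b : ℂ, ∀ z, g z = a + b * z := by
  have h2 : ∀ z, deriv (deriv g) z = 0 := by
    intro z
    rw [← norm_le_zero_iff]
    refine le_of_forall_pos_le_add fun ε hε => ?_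
    rw [zero_add]
    have hev : ∀ᶠ R : ℝ in atTop, 6 * ‖g 0‖ ≤ ε / 2 * R ^ 2 :=
      ((tendsto_pow_atTop two_ne_zero).const_mul_atTop (half_pos hε)).eventually_ge_atTop _
    -- Borel–Carathéodory from radius 4R to 2R gives the factors 2 and 3. With ε/128, Cauchy's
    -- estimate on a circle of radius R then yields ε/2 + 6‖g 0‖/R² ≤ ε.
    obtain ⟨R, hR4, hR, hzR, hR1⟩ := ((tendsto_id.const_mul_atTop (zero_lt_four' ℝ)).eventually
      (h (ε / 128) (by positivity))).and (hev.and ((eventually_ge_atTop ‖z‖).and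
      (eventually_ge_atTop 1))) |>.exists
    have hRpos : (0 : ℝ) < R := by linarith
    have hbound : ∀ w ∈ Metric.sphere z R,
        ‖g w‖ ≤ 2 * (ε / 128 * (4 * R) ^ 2) + 3 * ‖g 0‖ := by
      intro w hw
      have hw2 : ‖w‖ ≤ 2 * R := by
        calc ‖w‖ ≤ ‖w - z‖ + ‖z‖ := norm_le_norm_sub_add _ _
          _ ≤ R + R := add_le_add (by rw [← dist_eq_norm]; exact hw.le) hzR
          _ = 2 * R := by ring
      have hb := Complex.borelCaratheodory (f := g) (M := ε / 128 * (4 * R) ^ 2) (R := 4 * R)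
        (z := w) (by positivity) hg.differentiableOn
        (fun x hx => hR4 x (mem_ball_zero_iff.mp hx).le) (by positivity)
        (by rw [mem_ball_zero_iff]; linarith)
      refine hb.trans (add_le_add ?_ ?_)
      · rw [div_le_iff₀ (by linarith)]
        exact mul_le_mul_of_nonneg_left (by linarith) (by positivity)
      · rw [div_le_iff₀ (by linarith), mul_comm 3, mul_assoc]
        exact mul_le_mul_of_nonneg_left (by linarith) (norm_nonneg _)
    have hC := Complex.norm_iteratedDeriv_le_of_forall_mem_sphere_norm_le 2 hRpos
      hg.diffContOnCl hbound
    have hd : iteratedDeriv 2 g z = deriv (deriv g) z := by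
      rw [iteratedDeriv_succ, iteratedDeriv_one]
    rw [hd] at hC
    refine hC.trans ?_
    rw [div_le_iff₀ (by positivity)]
    norm_num
    nlinarith
  have h1 : ∀ z, deriv g z = deriv g 0 := fun z => is_const_of_deriv_eq_zero hg.deriv h2 z 0
  refine ⟨g 0, deriv g 0, fun z => ?_⟩
  have hq : ∀ w, HasDerivAt (fun z => g z - deriv g 0 * z) 0 w := fun w => by
    refine ((hg w).hasDerivAt.sub ((hasDerivAt_id w).const_mul (deriv g 0))).congr_deriv ?_
    rw [h1 w, mul_one, sub_self]
  have hc := is_const_of_deriv_eq_zero (fun w => (hq w).differentiableAt)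
    (fun w => (hq w).deriv) z 0
  simp only [mul_zero, sub_zero] at hc
  rw [← hc]
  ring

/-! ### Growth of the completed zeta function -/

open MeasureTheory in
/-- A Mellin transform is bounded on vertical strips of convergence. -/
theorem exists_norm_mellin_le {f : ℝ → ℂ} {a b : ℝ} (ha : MellinConvergent f a)
    (hb : MellinConvergent f b) :
    ∃ C, ∀ s : ℂ, a ≤ s.re → s.re ≤ b → ‖mellin f s‖ ≤ C := by
  refine ⟨∫ t in Set.Ioi (0 : ℝ), ‖(t : ℂ) ^ ((a : ℂ) - 1) • f t‖ + ‖(t : ℂ) ^ ((b : ℂ) - 1) • f t‖,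
    fun s has hsb => norm_integral_le_of_norm_le (ha.norm.add hb.norm) ?_⟩
  refine ae_restrict_of_forall_mem measurableSet_Ioi fun t ht => ?_
  simp only [norm_smul, ← add_mul, Complex.norm_cpow_eq_rpow_re_of_pos ht, Complex.sub_re,
    Complex.ofReal_re, Complex.one_re]
  refine mul_le_mul_of_nonneg_right ?_ (norm_nonneg _)
  rcases le_total t 1 with h | h
  · exact (Real.rpow_le_rpow_of_exponent_ge ht h (by linarith)).trans
      (le_add_of_nonneg_right (Real.rpow_nonneg ht.le _))
  · exact (Real.rpow_le_rpow_of_exponent_le h (by linarith)).trans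
      (le_add_of_nonneg_left (Real.rpow_nonneg ht.le _))

theorem exists_norm_completedRiemannZeta₀_le_of_re_le (a b : ℝ) :
    ∃ C, ∀ s : ℂ, a ≤ s.re → s.re ≤ b → ‖completedRiemannZeta₀ s‖ ≤ C := by
  set P := HurwitzZeta.hurwitzEvenFEPair 0 with hP
  -- The modified theta kernel decays rapidly at both ends, so its Mellin transform, which defines
  -- Λ₀, converges for every s.
  have hconv : ∀ s : ℂ, MellinConvergent P.f_modif s := fun s =>
    (P.isStrongFEPair_toStrongFEPair.hasMellin s).1
  obtain ⟨C, hC⟩ := exists_norm_mellin_le (hconv ((a / 2 : ℝ) : ℂ)) (hconv ((b / 2 : ℝ) : ℂ))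
  refine ⟨C / 2, fun s ha hb => ?_⟩
  have h1 : completedRiemannZeta₀ s = mellin P.f_modif (s / 2) / 2 := rfl
  rw [h1, norm_div, RCLike.norm_ofNat]
  have h2 : (s / 2).re = s.re / 2 := by simp
  exact div_le_div_of_nonneg_right (hC _ (by rw [h2]; linarith) (by rw [h2]; linarith)) two_pos.le

theorem Complex.norm_Gamma_le_Gamma_re {s : ℂ} (hs : 0 < s.re) : ‖Gamma s‖ ≤ Real.Gamma s.re := by
  rw [Gamma_eq_integral hs, Real.Gamma_eq_integral hs, GammaIntegral]
  refine MeasureTheory.norm_integral_le_of_norm_le (Real.GammaIntegral_convergent hs) ?_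
  refine MeasureTheory.ae_restrict_of_forall_mem measurableSet_Ioi fun x hx => ?_
  rw [norm_mul, norm_cpow_eq_rpow_re_of_pos hx, norm_real, Real.norm_eq_abs,
    abs_of_pos (Real.exp_pos _), sub_re, one_re]

theorem Real.Gamma_le_factorial_ceil {x : ℝ} (hx : 1 ≤ x) : Gamma x ≤ (⌈x⌉₊).factorial := by
  rw [← Gamma_nat_eq_factorial]
  have h1 : Gamma x ≤ Gamma (x + 1) := by
    rw [Gamma_add_one (by linarith)]
    exact le_mul_of_one_le_left (Gamma_pos_of_pos (by linarith)).le hx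
  refine h1.trans (Gamma_strictMonoOn_Ici.monotoneOn ?_ ?_ ?_)
  · rw [Set.mem_Ici]; linarith
  · rw [Set.mem_Ici]; linarith [Nat.le_ceil x]
  · linarith [Nat.le_ceil x]

theorem exists_norm_riemannZeta_le : ∃ C, ∀ s : ℂ, 2 ≤ s.re → ‖riemannZeta s‖ ≤ C := by
  refine ⟨∑' n : ℕ, 1 / (n : ℝ) ^ (2 : ℝ), fun s hs => ?_⟩
  rw [zeta_eq_tsum_one_div_nat_cpow (by linarith)]
  have hsum : Summable fun n : ℕ => 1 / (n : ℝ) ^ (2 : ℝ) :=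
    Real.summable_one_div_nat_rpow.mpr (by norm_num)
  refine tsum_of_norm_bounded hsum.hasSum fun n => ?_
  rw [norm_div, norm_one]
  rcases Nat.eq_zero_or_pos n with rfl | hn
  · rw [Nat.cast_zero, Complex.zero_cpow (fun h => by simp [h] at hs; linarith)]
    simp
  · rw [Complex.norm_natCast_cpow_of_pos hn]
    exact one_div_le_one_div_of_le (Real.rpow_pos_of_pos (by exact_mod_cast hn) _)
      (Real.rpow_le_rpow_of_exponent_le (by exact_mod_cast hn) hs)

/-- On 0 ≤ Re s ≤ 2 the function is bounded; for Re s ≥ 2, ζ is bounded and the Gamma factor is at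
most n!; for Re s < 0 the functional equation applies, and the +1 in the hypothesis leaves room for
1 - s. -/
theorem exists_norm_completedRiemannZeta₀_le_factorial :
    ∃ C > 0, ∀ (n : ℕ) (s : ℂ), ‖s‖ + 1 ≤ n → ‖completedRiemannZeta₀ s‖ ≤ C * n.factorial := by
  obtain ⟨A, hA⟩ := exists_norm_completedRiemannZeta₀_le_of_re_le 0 2
  obtain ⟨B, hB⟩ := exists_norm_riemannZeta_le
  have hB0 : 0 ≤ B := (norm_nonneg _).trans (hB 2 (by simp))
  have key : ∀ (n : ℕ) (s : ℂ), 0 ≤ s.re → s.re ≤ n →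
      ‖completedRiemannZeta₀ s‖ ≤ (|A| + B + 2) * n.factorial := by
    intro n s hs hn
    have hfac : (1 : ℝ) ≤ n.factorial := by exact_mod_cast Nat.one_le_iff_ne_zero.mpr n.factorial_ne_zero
    rcases le_total s.re 2 with h2 | h2
    · calc ‖completedRiemannZeta₀ s‖ ≤ |A| := (hA s hs h2).trans (le_abs_self A)
        _ ≤ (|A| + B + 2) := by linarith
        _ ≤ _ := le_mul_of_one_le_right (by positivity) hfac
    · have hs0 : s ≠ 0 := fun h => by simp [h] at h2; linarith
      have h3 : completedRiemannZeta₀ s = riemannZeta s * Complex.Gammaℝ s + 1 / s + 1 / (1 - s) := by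
        rw [riemannZeta_def_of_ne_zero hs0, div_mul_cancel₀ _
          (Complex.Gammaℝ_ne_zero_of_re_pos (by linarith)), completedRiemannZeta_eq]
        ring
      have h4 : ‖Complex.Gammaℝ s‖ ≤ n.factorial := by
        have hre : (s / 2).re = s.re / 2 := by simp
        rw [Complex.Gammaℝ_def, norm_mul, Complex.norm_cpow_eq_rpow_re_of_pos Real.pi_pos]
        have h5 : Real.pi ^ (-s / 2).re ≤ 1 := by
          refine Real.rpow_le_one_of_one_le_of_nonpos (by linarith [Real.pi_gt_three]) ?_
          simp; linarith
        have h6 : ‖Complex.Gamma (s / 2)‖ ≤ n.factorial := by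
          refine (Complex.norm_Gamma_le_Gamma_re (by rw [hre]; linarith)).trans ?_
          rw [hre]
          refine (Real.Gamma_le_factorial_ceil (by linarith)).trans ?_
          exact_mod_cast Nat.factorial_le (Nat.ceil_le.mpr (by linarith))
        calc _ ≤ 1 * (n.factorial : ℝ) := mul_le_mul h5 h6 (norm_nonneg _) zero_le_one
          _ = _ := one_mul _
      have h7 : ‖1 / s‖ ≤ 1 := by
        rw [norm_div, norm_one]
        refine div_le_one_of_le₀ ?_ (norm_nonneg _)
        linarith [Complex.re_le_norm s]
      have h8 : ‖1 / (1 - s)‖ ≤ 1 := by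
        rw [norm_div, norm_one]
        refine div_le_one_of_le₀ ?_ (norm_nonneg _)
        have := Complex.re_le_norm (s - 1)
        rw [norm_sub_rev]
        simp at this; linarith
      rw [h3]
      refine (norm_add₃_le).trans ?_
      rw [norm_mul]
      have := mul_le_mul (hB s h2) h4 (norm_nonneg _) hB0
      nlinarith [abs_nonneg A]
  refine ⟨|A| + B + 2, by positivity, fun n s hs => ?_⟩
  rcases le_total 0 s.re with h | h
  · exact key n s h (by linarith [Complex.re_le_norm s])
  · rw [← completedRiemannZeta₀_one_sub]
    refine key n (1 - s) ?_ ?_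
    · simp; linarith
    · have := Complex.abs_re_le_norm s
      have := neg_le_abs s.re
      simp; linarith

/-! ### Existence of a zero with real part at least 1/2 -/

/-- The entire function `s (s - 1) Λ(s)`. -/
noncomputable def xiFunction (s : ℂ) : ℂ := s * (s - 1) * completedRiemannZeta₀ s + 1

theorem differentiable_xiFunction : Differentiable ℂ xiFunction :=
  ((differentiable_id.mul (differentiable_id.sub_const 1)).mul
    differentiable_completedZeta₀).add_const 1

theorem xiFunction_one_sub (s : ℂ) : xiFunction (1 - s) = xiFunction s := by
  simp only [xiFunction, completedRiemannZeta₀_one_sub]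
  ring

theorem xiFunction_eq {s : ℂ} (h0 : s ≠ 0) (h1 : s ≠ 1) :
    xiFunction s = s * (s - 1) * completedRiemannZeta s := by
  have h2 : s - 1 ≠ 0 := sub_ne_zero.mpr h1
  have h3 : 1 - s ≠ 0 := sub_ne_zero.mpr h1.symm
  rw [xiFunction, completedRiemannZeta_eq]
  field_simp
  ring

open Filter in
-- Growth exp(o(R²)) is all that `eq_affine_of_re_le` needs, so the crude n! ≤ exp(n log n) with n ≤
-- 2R suffices. Half of the exponent absorbs the factorial, half the polynomial factor.
theorem eventually_norm_xiFunction_le {ε : ℝ} (hε : 0 < ε) :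
    ∀ᶠ R : ℝ in atTop, ∀ z, ‖z‖ ≤ R → ‖xiFunction z‖ ≤ Real.exp (ε * R ^ 2) := by
  obtain ⟨C, hC0, hC⟩ := exists_norm_completedRiemannZeta₀_le_factorial
  have hlog : ∀ᶠ x : ℝ in atTop, Real.log x ≤ ε / 8 * x := by
    filter_upwards [Real.isLittleO_log_id_atTop.bound (show (0 : ℝ) < ε / 8 by positivity),
      eventually_ge_atTop 0] with x hx hx0
    rw [id, Real.norm_of_nonneg hx0] at hx
    exact (le_abs_self _).trans hx
  have hceil : Tendsto (fun R : ℝ => ((⌈R + 1⌉₊ : ℕ) : ℝ)) atTop atTop :=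
    tendsto_atTop_mono (fun R => (le_add_of_nonneg_right zero_le_one).trans (Nat.le_ceil _))
      tendsto_id
  filter_upwards [hceil.eventually hlog, eventually_ge_atTop 2,
    ((tendsto_pow_atTop two_ne_zero).const_mul_atTop
      (show (0 : ℝ) < (ε / 2) ^ 2 by positivity)).eventually_ge_atTop (8 * C)] with R hl hR hCR z hz
  set n := ⌈R + 1⌉₊ with hn
  have hn1 : R + 1 ≤ n := Nat.le_ceil _
  have hn2 : (n : ℝ) ≤ 2 * R := by linarith [Nat.ceil_lt_add_one (show 0 ≤ R + 1 by linarith)]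
  have hnpos : (0 : ℝ) < n := by linarith
  have hfac : (n.factorial : ℝ) ≤ Real.exp (ε / 2 * R ^ 2) := by
    calc (n.factorial : ℝ) ≤ (n : ℝ) ^ n := by exact_mod_cast n.factorial_le_pow
      _ = Real.exp (n * Real.log n) := by rw [Real.exp_nat_mul, Real.exp_log hnpos]
      _ ≤ Real.exp (ε / 2 * R ^ 2) := by
        refine Real.exp_le_exp.mpr ?_
        calc (n : ℝ) * Real.log n ≤ n * (ε / 8 * n) := mul_le_mul_of_nonneg_left hl hnpos.le
          _ = ε / 8 * (n : ℝ) ^ 2 := by ring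
          _ ≤ ε / 8 * (2 * R) ^ 2 := by gcongr
          _ = _ := by ring
  have hone : (1 : ℝ) ≤ n.factorial := by
    exact_mod_cast Nat.one_le_iff_ne_zero.mpr n.factorial_ne_zero
  have hpoly : 4 * C * R ^ 2 + 1 ≤ Real.exp (ε / 2 * R ^ 2) := by
    have h1 := Real.quadratic_le_exp_of_nonneg (show 0 ≤ ε / 2 * R ^ 2 by positivity)
    have h2 : 8 * C * R ^ 2 ≤ (ε / 2 * R ^ 2) ^ 2 := by
      calc 8 * C * R ^ 2 ≤ (ε / 2) ^ 2 * R ^ 2 * R ^ 2 := by gcongr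
        _ = _ := by ring
    have h3 : 0 ≤ ε / 2 * R ^ 2 := by positivity
    linarith
  have hz1 : ‖z - 1‖ ≤ 2 * R := by
    calc ‖z - 1‖ ≤ ‖z‖ + ‖(1 : ℂ)‖ := norm_sub_le _ _
      _ ≤ 2 * R := by rw [norm_one]; linarith
  calc ‖xiFunction z‖ ≤ ‖z‖ * ‖z - 1‖ * ‖completedRiemannZeta₀ z‖ + 1 := by
        refine (norm_add_le _ _).trans ?_
        rw [norm_mul, norm_mul, norm_one]
    _ ≤ R * (2 * R) * (C * n.factorial) + 1 := by
        gcongr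
        exact hC n z (by linarith)
    _ ≤ (4 * C * R ^ 2 + 1) * n.factorial := by
        have : 0 ≤ C * R ^ 2 * n.factorial := by positivity
        nlinarith
    _ ≤ Real.exp (ε / 2 * R ^ 2) * Real.exp (ε / 2 * R ^ 2) := by gcongr
    _ = Real.exp (ε * R ^ 2) := by rw [← Real.exp_add]; ring_nf

theorem exists_xiFunction_eq_zero : ∃ ρ, xiFunction ρ = 0 := by
  by_contra! hne
  obtain ⟨g, hg, hexp⟩ := exists_eq_cexp_of_forall_ne_zero differentiable_xiFunction hne
  obtain ⟨a, b, hab⟩ := eq_affine_of_re_le hg fun ε hε => by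
    filter_upwards [eventually_norm_xiFunction_le hε] with R hR z hz
    have := hR z hz
    rwa [hexp, Complex.norm_exp, Real.exp_le_exp] at this
  simp only [hab] at hexp
  have hsymm : ∀ z : ℂ, Complex.exp (b * z) = Complex.exp (b * (1 - z)) := fun z => by
    have h := xiFunction_one_sub z
    rw [hexp, hexp, Complex.exp_add, Complex.exp_add] at h
    exact (mul_left_cancel₀ (Complex.exp_ne_zero a) h).symm
  -- At the fixed point 1/2 of z ↦ 1 - z, the two sides of the symmetry have opposite derivatives.
  have hb : b = 0 := by
    have h1 : HasDerivAt (fun z : ℂ => Complex.exp (b * z)) (Complex.exp (b * (1 / 2)) * (b * 1))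
      (1 / 2) := ((hasDerivAt_id (1 / 2 : ℂ)).const_mul b).cexp
    have h2 : HasDerivAt (fun z : ℂ => Complex.exp (b * (1 - z)))
      (Complex.exp (b * (1 - 1 / 2)) * (b * (-1))) (1 / 2) :=
      (((hasDerivAt_id (1 / 2 : ℂ)).const_sub 1).const_mul b).cexp
    rw [← funext hsymm] at h2
    have h3 := h1.unique h2
    rw [show (1 : ℂ) - 1 / 2 = 1 / 2 by norm_num] at h3
    have h4 := mul_left_cancel₀ (Complex.exp_ne_zero _) h3
    linear_combination h4 / 2
  have h0 : xiFunction 0 = 1 := by simp [xiFunction]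
  have h2 : xiFunction 2 = 1 := by rw [← h0, hexp, hexp, hb, zero_mul, zero_mul]
  rw [xiFunction_eq two_ne_zero (by norm_num)] at h2
  have h3 : completedRiemannZeta 2 = Complex.Gammaℝ 2 * riemannZeta 2 := by
    rw [riemannZeta_def_of_ne_zero two_ne_zero, mul_div_cancel₀ _
      (Complex.Gammaℝ_ne_zero_of_re_pos (by simp))]
  -- Here ξ(2) = 2 · π⁻¹ · π²/6 = π/3, so constancy would force π = 3.
  rw [h3, riemannZeta_two, Complex.Gammaℝ_def, div_self two_ne_zero, Complex.Gamma_one,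
    show (-2 / 2 : ℂ) = -1 by norm_num, Complex.cpow_neg_one] at h2
  have hpi : (Real.pi : ℂ) ≠ 0 := Complex.ofReal_ne_zero.mpr Real.pi_ne_zero
  have h4 : (Real.pi : ℂ) = 3 := by
    field_simp at h2
    linear_combination h2 / 2
  have h5 : Real.pi = 3 := by exact_mod_cast h4
  exact Real.pi_gt_three.ne' h5

/-- There is a zero `ρ ≠ 1` of `(s - 1) ζ(s)` with real part at least `1 / 2`. -/
theorem exists_riemannZeta₁_eq_zero : ∃ ρ : ℂ, 1 / 2 ≤ ρ.re ∧ ρ ≠ 1 ∧ riemannZeta₁ ρ = 0 := by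
  have key : ∀ ρ : ℂ, 1 / 2 ≤ ρ.re → xiFunction ρ = 0 →
      1 / 2 ≤ ρ.re ∧ ρ ≠ 1 ∧ riemannZeta₁ ρ = 0 := by
    intro ρ hre hρ
    have h0 : ρ ≠ 0 := fun h => by simp [h] at hre; linarith
    have h1 : ρ ≠ 1 := fun h => by simp [h, xiFunction] at hρ
    have h2 : ρ - 1 ≠ 0 := sub_ne_zero.mpr h1
    refine ⟨hre, h1, ?_⟩
    rw [xiFunction_eq h0 h1] at hρ
    have h3 : completedRiemannZeta ρ = 0 := by simpa [h0, h2] using hρ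
    have h4 := riemannZeta_eq_inv_sub_mul h1
    rw [riemannZeta_def_of_ne_zero h0, h3, zero_div] at h4
    simpa [h2] using h4.symm
  obtain ⟨ρ, hρ⟩ := exists_xiFunction_eq_zero
  rcases le_total (1 / 2) ρ.re with h | h
  · exact ⟨ρ, key ρ h hρ⟩
  · refine ⟨1 - ρ, key (1 - ρ) ?_ (by rw [xiFunction_one_sub, hρ])⟩
    rw [Complex.sub_re, Complex.one_re]
    linarith

/-! ### Mellin transforms of primitives and of M -/

open MeasureTheory in
theorem integrableOn_mul_cpow_of_abs_le {f : ℝ → ℝ}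
    (hf : AEStronglyMeasurable f (volume.restrict (Set.Ioi 1))) {C q : ℝ}
    (hb : ∀ x > 1, |f x| ≤ C * x ^ q) {w : ℂ} (hw : q < w.re) :
    IntegrableOn (fun x : ℝ => (f x : ℂ) * (x : ℂ) ^ (-(w + 1))) (Set.Ioi 1) := by
  have h1 : IntegrableOn (fun x : ℝ => C * x ^ (q - w.re - 1)) (Set.Ioi 1) :=
    (integrableOn_Ioi_rpow_of_lt (by linarith) one_pos).const_mul C
  refine Integrable.mono' h1 ?_ ?_
  · refine (Complex.continuous_ofReal.comp_aestronglyMeasurable hf).mul ?_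
    exact (Measurable.pow_const Complex.measurable_ofReal _).aestronglyMeasurable
  · refine ae_restrict_of_forall_mem measurableSet_Ioi fun x hx => ?_
    have hx0 : (0 : ℝ) < x := zero_lt_one.trans hx
    rw [norm_mul, Complex.norm_real, Real.norm_eq_abs, Complex.norm_cpow_eq_rpow_re_of_pos hx0]
    calc |f x| * x ^ (-(w + 1)).re ≤ C * x ^ q * x ^ (-(w + 1)).re :=
          mul_le_mul_of_nonneg_right (hb x hx) (Real.rpow_nonneg hx0.le _)
      _ = C * x ^ (q - w.re - 1) := by
        rw [mul_assoc, ← Real.rpow_add hx0]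
        simp only [Complex.neg_re, Complex.add_re, Complex.one_re]
        ring_nf

open MeasureTheory in
/-- The Mellin transform of a primitive. -/
theorem integral_primitive_mul_cpow {h : ℝ → ℝ} (hm : Measurable h) {p : ℝ}
    (hb : ∀ u > 1, |h u| ≤ u ^ p) {w : ℂ} (hw0 : 0 < w.re) (hw : p + 1 < w.re) :
    ∫ x in Set.Ioi (1 : ℝ), ((∫ u in (1 : ℝ)..x, h u : ℝ) : ℂ) * (x : ℂ) ^ (-(w + 1)) =
      1 / w * ∫ u in Set.Ioi (1 : ℝ), (h u : ℂ) * (u : ℂ) ^ (-w) := by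
  -- Fubini for the region 1 < u ≤ x; the inner x-integral is u^{-w}/w.
  set k : ℝ → ℝ → ℂ := fun x u => if u ≤ x then (h u : ℂ) * (x : ℂ) ^ (-(w + 1)) else 0 with hk
  have hw1 : w ≠ 0 := fun h => by simp [h] at hw0
  have hkm : Measurable (Function.uncurry k) := by
    refine Measurable.ite (measurableSet_le measurable_snd measurable_fst) ?_ measurable_const
    exact ((Complex.measurable_ofReal.comp (hm.comp measurable_snd))).mul
      ((Complex.measurable_ofReal.comp measurable_fst).pow_const _)
  have hku : ∀ u : ℝ, (fun x => k x u) =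
      (Set.Ici u).indicator fun x : ℝ => (h u : ℂ) * (x : ℂ) ^ (-(w + 1)) := fun u => by
    ext x
    simp only [hk, Set.indicator_apply, Set.mem_Ici]
  have hkx : ∀ x : ℝ, (fun u => k x u) =
      (Set.Iic x).indicator fun u : ℝ => (h u : ℂ) * (x : ℂ) ^ (-(w + 1)) := fun x => by
    ext u
    simp only [hk, Set.indicator_apply, Set.mem_Iic]
  have hre : (-(w + 1)).re = -w.re - 1 := by simp; ring
  have hint : ∀ u : ℝ, 1 < u → IntegrableOn (fun x : ℝ => (h u : ℂ) * (x : ℂ) ^ (-(w + 1)))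
      (Set.Ioi u) := fun u hu =>
    (integrableOn_Ioi_cpow_of_lt (by rw [hre]; linarith) (zero_lt_one.trans hu)).const_mul _
  have hinter : ∀ u : ℝ, 1 < u → Set.Ioi 1 ∩ Set.Ici u = Set.Ici u := fun u hu =>
    Set.inter_eq_right.mpr fun x hx => lt_of_lt_of_le hu hx
  have hki : Integrable (Function.uncurry k)
      ((volume.restrict (Set.Ioi 1)).prod (volume.restrict (Set.Ioi 1))) := by
    rw [integrable_prod_iff' hkm.aestronglyMeasurable]
    constructor
    · refine ae_restrict_of_forall_mem measurableSet_Ioi fun u hu => ?_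
      change Integrable (fun x => k x u) _
      rw [hku]
      refine Integrable.indicator ?_ measurableSet_Ici |>.mono_measure le_rfl
      exact (integrableOn_Ioi_cpow_of_lt (by rw [hre]; linarith) one_pos).const_mul _
    · have hbd : IntegrableOn (fun u : ℝ => u ^ (p - w.re) * (1 / w.re)) (Set.Ioi 1) :=
        (integrableOn_Ioi_rpow_of_lt (by linarith) one_pos).mul_const _
      refine Integrable.mono' hbd ?_ ?_
      · exact (hkm.norm.stronglyMeasurable.integral_prod_left'
          (μ := volume.restrict (Set.Ioi 1))).aestronglyMeasurable
      · refine ae_restrict_of_forall_mem measurableSet_Ioi fun u hu => ?_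
        have hu0 : (0 : ℝ) < u := zero_lt_one.trans hu
        rw [Real.norm_of_nonneg (integral_nonneg fun x => norm_nonneg _)]
        have h1 : (fun x => ‖Function.uncurry k (x, u)‖) =
            (Set.Ici u).indicator fun x : ℝ => ‖(h u : ℂ) * (x : ℂ) ^ (-(w + 1))‖ := by
          ext x
          rw [← norm_indicator_eq_indicator_norm, ← hku u]
          rfl
        rw [h1, setIntegral_indicator measurableSet_Ici, hinter u hu,
          integral_Ici_eq_integral_Ioi]
        have h2 : ∫ x in Set.Ioi u, ‖(h u : ℂ) * (x : ℂ) ^ (-(w + 1))‖ =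
            ∫ x in Set.Ioi u, |h u| * x ^ (-w.re - 1) := by
          refine setIntegral_congr_fun measurableSet_Ioi fun x hx => ?_
          rw [norm_mul, Complex.norm_real, Real.norm_eq_abs,
            Complex.norm_cpow_eq_rpow_re_of_pos (hu0.trans hx), hre]
        rw [h2, integral_const_mul, integral_Ioi_rpow_of_lt (by linarith) hu0, sub_add_cancel,
          neg_div_neg_eq]
        calc |h u| * (u ^ (-w.re) / w.re) ≤ u ^ p * (u ^ (-w.re) / w.re) :=
              mul_le_mul_of_nonneg_right (hb u hu) (by positivity)
          _ = u ^ (p - w.re) * (1 / w.re) := by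
            rw [sub_eq_add_neg, Real.rpow_add hu0]
            ring
  have hswap := integral_integral_swap hki
  have hl : ∫ x in Set.Ioi (1 : ℝ), ∫ u in Set.Ioi (1 : ℝ), k x u = ∫ x in Set.Ioi (1 : ℝ),
      ((∫ u in (1 : ℝ)..x, h u : ℝ) : ℂ) * (x : ℂ) ^ (-(w + 1)) := by
    refine setIntegral_congr_fun measurableSet_Ioi fun x hx => ?_
    rw [hkx x, setIntegral_indicator measurableSet_Iic, Set.Ioi_inter_Iic, integral_mul_const,
      integral_complex_ofReal, intervalIntegral.integral_of_le (le_of_lt hx)]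
  have hr : ∫ u in Set.Ioi (1 : ℝ), ∫ x in Set.Ioi (1 : ℝ), k x u = ∫ u in Set.Ioi (1 : ℝ),
      1 / w * ((h u : ℂ) * (u : ℂ) ^ (-w)) := by
    refine setIntegral_congr_fun measurableSet_Ioi fun u hu => ?_
    rw [hku u, setIntegral_indicator measurableSet_Ici, hinter u hu, integral_Ici_eq_integral_Ioi,
      integral_const_mul, integral_Ioi_cpow_of_lt (by rw [hre]; linarith) (zero_lt_one.trans hu),
      show -(w + 1) + 1 = -w by ring, neg_div_neg_eq]
    ring
  rw [← hl, hswap, hr, integral_const_mul]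

theorem measurable_mertensM : Measurable mertensM :=
  (measurable_from_nat (f := fun n : ℕ =>
    ∑ n ∈ Finset.Icc 1 n, ((ArithmeticFunction.moebius n : ℤ) : ℝ))).comp Nat.measurable_floor

theorem abs_mertensM_le {x : ℝ} (hx : 0 ≤ x) : |mertensM x| ≤ x := by
  refine (Finset.abs_sum_le_sum_abs _ _).trans ?_
  refine (Finset.sum_le_card_nsmul _ _ 1 fun n _ => ?_).trans ?_
  · exact_mod_cast ArithmeticFunction.abs_moebius_le_one
  · simpa using Nat.floor_le hx

open Complex in
-- Partial summation of ∑ μ(n) n^{-s} = 1/ζ(s). Writing it with (s - 1)ζ(s) removes the pole at s =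
-- 1 from the denominator.
theorem integral_mertensM_mul_cpow {s : ℂ} (hs : 1 < s.re) :
    ∫ t in Set.Ioi (1 : ℝ), (mertensM t : ℂ) * (t : ℂ) ^ (-(s + 1)) =
      (s - 1) / (s * riemannZeta₁ s) := by
  have hs0 : s ≠ 0 := fun h => by simp [h] at hs; linarith
  have hs1 : s ≠ 1 := fun h => by simp [h] at hs
  have hs2 : s - 1 ≠ 0 := sub_ne_zero.mpr hs1
  have h1 := LSeries_eq_mul_integral' (fun n => ((ArithmeticFunction.moebius n : ℤ) : ℂ))
    zero_le_one hs (Asymptotics.IsBigO.of_bound 1 (Filter.Eventually.of_forall fun n => by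
      rw [Real.norm_of_nonneg (Finset.sum_nonneg fun _ _ => norm_nonneg _), Real.rpow_one,
        one_mul, Real.norm_natCast]
      refine (Finset.sum_le_card_nsmul _ _ 1 fun n _ => ?_).trans (by simp)
      rw [Complex.norm_intCast]
      exact_mod_cast ArithmeticFunction.abs_moebius_le_one))
  have h2 := ArithmeticFunction.LSeries_zeta_mul_Lseries_moebius hs
  rw [ArithmeticFunction.LSeries_zeta_eq_riemannZeta hs, h1, riemannZeta_eq_inv_sub_mul hs1] at h2
  have h3 : ∀ t : ℝ, ∑ k ∈ Finset.Icc 1 ⌊t⌋₊, ((ArithmeticFunction.moebius k : ℤ) : ℂ) =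
      (mertensM t : ℂ) := fun t => by simp [mertensM]
  simp_rw [h3] at h2
  have h4 : riemannZeta₁ s ≠ 0 := fun h => by simp [h] at h2
  rw [eq_div_iff (mul_ne_zero hs0 h4)]
  field_simp at h2
  linear_combination h2

/-! ### Mellin transforms as moment generating functions -/

/-- The measure `φ(x) dx / x` on `(1, ∞)`, whose exponential moments with respect to `-log x` are
the Mellin transform of `φ`. -/
noncomputable def mellinMeasure (φ : ℝ → ℝ) : MeasureTheory.Measure ℝ :=
  (MeasureTheory.volume.restrict (Set.Ioi 1)).withDensity fun x => ENNReal.ofReal (φ x / x)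

open MeasureTheory in
theorem ae_mellinMeasure_neg_log_nonpos (φ : ℝ → ℝ) :
    ∀ᵐ x ∂(mellinMeasure φ), -Real.log x ≤ 0 := by
  refine (withDensity_absolutelyContinuous _ _).ae_le ?_
  refine ae_restrict_of_forall_mem measurableSet_Ioi fun x hx => ?_
  exact neg_nonpos.mpr (Real.log_nonneg (le_of_lt hx))

theorem cexp_mul_neg_log {x : ℝ} (hx : 0 < x) (w : ℂ) :
    (x : ℂ)⁻¹ * Complex.exp (w * ((-Real.log x : ℝ) : ℂ)) = (x : ℂ) ^ (-(w + 1)) := by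
  have hx0 : (x : ℂ) ≠ 0 := Complex.ofReal_ne_zero.mpr hx.ne'
  rw [neg_add, Complex.cpow_add _ _ hx0, Complex.cpow_neg_one, mul_comm, Complex.cpow_def_of_ne_zero
    hx0, Complex.ofReal_neg, Complex.ofReal_log hx.le]
  ring_nf

section

open MeasureTheory ProbabilityTheory

theorem aemeasurable_ofReal_div_self {φ : ℝ → ℝ}
    (hφ : AEStronglyMeasurable φ (volume.restrict (Set.Ioi 1))) :
    AEMeasurable (fun x => ENNReal.ofReal (φ x / x)) (volume.restrict (Set.Ioi 1)) :=
  (hφ.aemeasurable.div aemeasurable_id).ennreal_ofReal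

theorem toReal_smul_cexp_eqOn {φ : ℝ → ℝ} (h0 : ∀ x > 1, 0 ≤ φ x) (w : ℂ) :
    Set.EqOn (fun x : ℝ => (ENNReal.ofReal (φ x / x)).toReal • Complex.exp
      (w * ((-Real.log x : ℝ) : ℂ))) (fun x => (φ x : ℂ) * (x : ℂ) ^ (-(w + 1))) (Set.Ioi 1) := by
  intro x hx
  have hx0 : (0 : ℝ) < x := zero_lt_one.trans hx
  simp only
  rw [ENNReal.toReal_ofReal (div_nonneg (h0 x hx) hx0.le), ← cexp_mul_neg_log hx0,
    Complex.real_smul, Complex.ofReal_div, div_eq_mul_inv, mul_assoc]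

theorem complexMGF_mellinMeasure {φ : ℝ → ℝ}
    (hφ : AEStronglyMeasurable φ (volume.restrict (Set.Ioi 1)))
    (h0 : ∀ x > 1, 0 ≤ φ x) (w : ℂ) :
    complexMGF (fun x => -Real.log x) (mellinMeasure φ) w =
      ∫ x in Set.Ioi (1 : ℝ), (φ x : ℂ) * (x : ℂ) ^ (-(w + 1)) := by
  rw [complexMGF, mellinMeasure, integral_withDensity_eq_integral_toReal_smul₀
    (aemeasurable_ofReal_div_self hφ) (ae_of_all _ fun _ => ENNReal.ofReal_lt_top)]
  exact setIntegral_congr_fun measurableSet_Ioi (toReal_smul_cexp_eqOn h0 w)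

theorem mem_integrableExpSet_mellinMeasure {φ : ℝ → ℝ}
    (hφ : AEStronglyMeasurable φ (volume.restrict (Set.Ioi 1)))
    (h0 : ∀ x > 1, 0 ≤ φ x) {t : ℝ}
    (ht : IntegrableOn (fun x : ℝ => (φ x : ℂ) * (x : ℂ) ^ (-((t : ℂ) + 1))) (Set.Ioi 1)) :
    t ∈ integrableExpSet (fun x => -Real.log x) (mellinMeasure φ) := by
  have h1 : Integrable (fun x : ℝ => Complex.exp ((t : ℂ) * ((-Real.log x : ℝ) : ℂ)))
      (mellinMeasure φ) := by
    rw [mellinMeasure, integrable_withDensity_iff_integrable_smul₀'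
      (aemeasurable_ofReal_div_self hφ) (ae_of_all _ fun _ => ENNReal.ofReal_lt_top)]
    exact (integrableOn_congr_fun (toReal_smul_cexp_eqOn h0 t) measurableSet_Ioi).mpr ht
  refine h1.re.congr (ae_of_all _ fun x => ?_)
  simp only [← Complex.ofReal_mul, ← Complex.ofReal_exp]
  exact Complex.ofReal_re _

end

/-! ### The primitive of M(u) u^{-κ} -/

/-- The primitive `∫₁ˣ M(u) u^{-κ} du`. -/
noncomputable def mertensPrimitive (κ x : ℝ) : ℝ := ∫ u in (1 : ℝ)..x, mertensM u / u ^ κ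

theorem abs_mertensM_div_rpow_le (κ : ℝ) {u : ℝ} (hu : 1 ≤ u) :
    |mertensM u / u ^ κ| ≤ u ^ (1 + |κ|) := by
  have hu0 : 0 < u := zero_lt_one.trans_le hu
  rw [abs_div, abs_of_pos (Real.rpow_pos_of_pos hu0 κ), div_le_iff₀ (Real.rpow_pos_of_pos hu0 κ),
    ← Real.rpow_add hu0]
  refine (abs_mertensM_le hu0.le).trans ?_
  refine (Real.rpow_one u).symm.le.trans (Real.rpow_le_rpow_of_exponent_le hu ?_)
  linarith [neg_le_abs κ]

theorem continuousOn_mertensPrimitive (κ : ℝ) :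
    ContinuousOn (mertensPrimitive κ) (Set.Ici 1) := by
  intro x hx
  have h1x : (1 : ℝ) ≤ x := hx
  have h := intervalIntegral.continuousOn_primitive_interval'
    (intervalIntegrable_mertensM_div_rpow κ (x + 1) (by linarith)) Set.left_mem_uIcc
  rw [Set.uIcc_of_le (by linarith)] at h
  refine (h x ⟨h1x, by linarith⟩).mono_of_mem_nhdsWithin ?_
  filter_upwards [self_mem_nhdsWithin, mem_nhdsWithin_of_mem_nhds (Iio_mem_nhds (lt_add_one x))]
    with y hy hy2
  exact ⟨hy, le_of_lt hy2⟩

theorem abs_mertensPrimitive_le (κ : ℝ) {x : ℝ} (hx : 1 ≤ x) :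
    |mertensPrimitive κ x| ≤ x ^ (2 + |κ|) := by
  have hx0 : 0 < x := zero_lt_one.trans_le hx
  have h := intervalIntegral.norm_integral_le_of_norm_le_const (a := 1) (b := x)
    (f := fun u => mertensM u / u ^ κ) (C := x ^ (1 + |κ|)) fun u hu => by
      rw [Set.uIoc_of_le hx] at hu
      exact (abs_mertensM_div_rpow_le κ hu.1.le).trans
        (Real.rpow_le_rpow (by linarith [hu.1]) hu.2 (by positivity))
  refine h.trans ?_
  rw [abs_of_nonneg (show 0 ≤ x - 1 by linarith), show 2 + |κ| = (1 + |κ|) + 1 by ring, Real.rpow_add_one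
    hx0.ne']
  exact mul_le_mul_of_nonneg_left (by linarith) (Real.rpow_nonneg hx0.le _)

open MeasureTheory in
theorem integrableOn_mertensPrimitive_mul_cpow (κ : ℝ) {w : ℂ} (hw : 2 + |κ| < w.re) :
    IntegrableOn (fun x : ℝ => (mertensPrimitive κ x : ℂ) * (x : ℂ) ^ (-(w + 1))) (Set.Ioi 1) :=
  integrableOn_mul_cpow_of_abs_le (C := 1)
    (((continuousOn_mertensPrimitive κ).mono Set.Ioi_subset_Ici_self).aestronglyMeasurable
      measurableSet_Ioi)
    (fun x hx => by rw [one_mul]; exact abs_mertensPrimitive_le κ (le_of_lt hx)) hw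

/-- The factor u^{-κ} shifts the transform of M to s = w + κ - 1, and integration contributes 1/w.
The half-plane comes from the trivial bound |M(u)| ≤ u. -/
theorem integral_mertensPrimitive_mul_cpow (κ : ℝ) {w : ℂ} (hw : 2 + |κ| < w.re) :
    ∫ x in Set.Ioi (1 : ℝ), (mertensPrimitive κ x : ℂ) * (x : ℂ) ^ (-(w + 1)) =
      1 / w * ((w + κ - 1 - 1) / ((w + κ - 1) * riemannZeta₁ (w + κ - 1))) := by
  have hs : 1 < (w + κ - 1).re := by
    simp only [Complex.sub_re, Complex.add_re, Complex.ofReal_re, Complex.one_re]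
    linarith [neg_abs_le κ]
  have hm : Measurable fun u => mertensM u / u ^ κ :=
    measurable_mertensM.div (measurable_id.pow_const κ)
  have h1 := integral_primitive_mul_cpow hm
    (fun u hu => abs_mertensM_div_rpow_le κ (le_of_lt hu)) (w := w)
    (by linarith [abs_nonneg κ]) (by linarith)
  rw [← integral_mertensM_mul_cpow hs]
  refine h1.trans ?_
  congr 1
  refine MeasureTheory.setIntegral_congr_fun measurableSet_Ioi fun u hu => ?_
  have hu0 : (0 : ℝ) < u := zero_lt_one.trans hu
  have hu1 : (u : ℂ) ≠ 0 := Complex.ofReal_ne_zero.mpr hu0.ne'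
  rw [show -(w + κ - 1 + 1) = -κ + -w by ring, Complex.cpow_add _ _ hu1, ← Complex.ofReal_neg,
    ← Complex.ofReal_cpow hu0.le, Real.rpow_neg hu0.le, ← mul_assoc, div_eq_mul_inv,
    Complex.ofReal_mul]

/-- The Mellin transform of a real power. -/
theorem integral_rpow_mul_cpow (a : ℝ) {w : ℂ} (hw : a < w.re) :
    MeasureTheory.IntegrableOn (fun x : ℝ => ((x ^ a : ℝ) : ℂ) * (x : ℂ) ^ (-(w + 1)))
      (Set.Ioi 1) ∧
    ∫ x in Set.Ioi (1 : ℝ), ((x ^ a : ℝ) : ℂ) * (x : ℂ) ^ (-(w + 1)) = 1 / (w - a) := by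
  have heq : Set.EqOn (fun x : ℝ => ((x ^ a : ℝ) : ℂ) * (x : ℂ) ^ (-(w + 1)))
      (fun x : ℝ => (x : ℂ) ^ (a - w - 1)) (Set.Ioi 1) := fun x hx => by
    have hx0 : (0 : ℝ) < x := zero_lt_one.trans hx
    simp only
    rw [Complex.ofReal_cpow hx0.le, ← Complex.cpow_add _ _ (Complex.ofReal_ne_zero.mpr hx0.ne')]
    ring_nf
  have hre : (a - w - 1 : ℂ).re < -1 := by simp; linarith
  refine ⟨(MeasureTheory.integrableOn_congr_fun heq measurableSet_Ioi).mpr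
    (integrableOn_Ioi_cpow_of_lt hre one_pos), ?_⟩
  rw [MeasureTheory.setIntegral_congr_fun measurableSet_Ioi heq, integral_Ioi_cpow_of_lt hre
    one_pos, Complex.ofReal_one, Complex.one_cpow, sub_add_cancel, ← neg_sub w, neg_div_neg_eq]

/-! ### The nonnegative test function and its transform -/

/-- The function `τ (∫₁ˣ M(u) u^{-κ} du - c) + ε x^{3/2-κ} + K / x`. If its first two terms are
eventually nonnegative, then `K` can be chosen to make it nonnegative on `(1, ∞)`. -/
noncomputable def oscillationTest (κ ε c τ K x : ℝ) : ℝ :=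
  ε * x ^ (3 / 2 - κ) + τ * (mertensPrimitive κ x - c) + K * x ^ (-1 : ℝ)

/-- The Mellin transform of `oscillationTest`. -/
noncomputable def oscillationTransform (κ ε c τ K : ℝ) (w : ℂ) : ℂ :=
  ε / (w - (3 / 2 - κ)) + τ * (1 / w * ((w + κ - 1 - 1) /
    ((w + κ - 1) * riemannZeta₁ (w + κ - 1))) - c / w) + K / (w + 1)

open Filter in
theorem exists_oscillationTest_nonneg {κ ε c τ : ℝ} (hε : 0 ≤ ε)
    (h : ∀ᶠ x in atTop, -(ε * x ^ (3 / 2 - κ)) ≤ τ * (mertensPrimitive κ x - c)) :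
    ∃ K, ∀ x > 1, 0 ≤ oscillationTest κ ε c τ K x := by
  obtain ⟨X, hX⟩ := eventually_atTop.mp h
  have hcont : ContinuousOn (fun x => x * (τ * (mertensPrimitive κ x - c))) (Set.Icc 1 X) :=
    continuousOn_id.mul (continuousOn_const.mul
      (((continuousOn_mertensPrimitive κ).mono Set.Icc_subset_Ici_self).sub continuousOn_const))
  obtain ⟨B, hB⟩ := isCompact_Icc.exists_bound_of_continuousOn hcont
  -- Only the compact range up to X needs repair. The correction K/x has its single pole at w = -1,
  -- left of 3/2 - κ ≥ 0, so the size of K never matters.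
  refine ⟨max B 0, fun x hx => ?_⟩
  have hx0 : (0 : ℝ) < x := zero_lt_one.trans hx
  have hpow : 0 ≤ ε * x ^ (3 / 2 - κ) := mul_nonneg hε (Real.rpow_nonneg hx0.le _)
  rw [oscillationTest, Real.rpow_neg_one]
  rcases le_total X x with hXx | hXx
  · have h1 : 0 ≤ max B 0 * x⁻¹ := by positivity
    linarith [hX x hXx]
  · have h1 := (neg_le_of_abs_le ((hB x ⟨le_of_lt hx, hXx⟩).trans (le_max_left B 0)))
    have h2 : -(max B 0 * x⁻¹) ≤ τ * (mertensPrimitive κ x - c) := by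
      rw [← neg_mul, mul_inv_le_iff₀ hx0]
      linarith
    linarith

theorem aestronglyMeasurable_oscillationTest (κ ε c τ K : ℝ) :
    MeasureTheory.AEStronglyMeasurable (oscillationTest κ ε c τ K)
      (MeasureTheory.volume.restrict (Set.Ioi 1)) := by
  refine ContinuousOn.aestronglyMeasurable ?_ measurableSet_Ioi
  have hF := (continuousOn_mertensPrimitive κ).mono Set.Ioi_subset_Ici_self
  have hp : ∀ r : ℝ, ContinuousOn (fun x : ℝ => x ^ r) (Set.Ioi 1) := fun r x hx =>
    (Real.continuousAt_rpow_const x r (Or.inl (zero_lt_one.trans hx).ne')).continuousWithinAt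
  exact ((continuousOn_const.mul (hp _)).add (continuousOn_const.mul
    (hF.sub continuousOn_const))).add (continuousOn_const.mul (hp _))

open MeasureTheory in
theorem integral_oscillationTest_mul_cpow (κ ε c τ K : ℝ) {w : ℂ} (hw : 2 + |κ| < w.re) :
    IntegrableOn (fun x : ℝ => (oscillationTest κ ε c τ K x : ℂ) * (x : ℂ) ^ (-(w + 1)))
      (Set.Ioi 1) ∧
    ∫ x in Set.Ioi (1 : ℝ), (oscillationTest κ ε c τ K x : ℂ) * (x : ℂ) ^ (-(w + 1)) =
      oscillationTransform κ ε c τ K w := by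
  have ha := abs_nonneg κ
  obtain ⟨i1, e1⟩ := integral_rpow_mul_cpow (3 / 2 - κ) (w := w) (by linarith [neg_abs_le κ])
  obtain ⟨i2, e2⟩ := integral_rpow_mul_cpow (-1) (w := w) (by linarith)
  obtain ⟨i3, e3⟩ := integral_rpow_mul_cpow 0 (w := w) (by linarith)
  have i4 := integrableOn_mertensPrimitive_mul_cpow κ hw
  have e4 := integral_mertensPrimitive_mul_cpow κ hw
  have hsplit : ∀ x : ℝ, (oscillationTest κ ε c τ K x : ℂ) * (x : ℂ) ^ (-(w + 1)) =
      ε * (((x ^ (3 / 2 - κ) : ℝ) : ℂ) * (x : ℂ) ^ (-(w + 1))) +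
      (τ * ((mertensPrimitive κ x : ℂ) * (x : ℂ) ^ (-(w + 1)) -
        c * (((x ^ (0 : ℝ) : ℝ) : ℂ) * (x : ℂ) ^ (-(w + 1)))) +
      K * (((x ^ (-1 : ℝ) : ℝ) : ℂ) * (x : ℂ) ^ (-(w + 1)))) := fun x => by
    rw [oscillationTest, Real.rpow_zero]
    push_cast
    ring
  simp_rw [hsplit]
  have j1 := i1.const_mul (ε : ℂ)
  have j2 : IntegrableOn (fun x : ℝ => τ * ((mertensPrimitive κ x : ℂ) * (x : ℂ) ^ (-(w + 1)) -
      c * (((x ^ (0 : ℝ) : ℝ) : ℂ) * (x : ℂ) ^ (-(w + 1))))) (Set.Ioi 1) :=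
    (i4.sub (i3.const_mul (c : ℂ))).const_mul (τ : ℂ)
  have j3 := i2.const_mul (K : ℂ)
  have j4 : IntegrableOn (fun x : ℝ => τ * ((mertensPrimitive κ x : ℂ) * (x : ℂ) ^ (-(w + 1)) -
      c * (((x ^ (0 : ℝ) : ℝ) : ℂ) * (x : ℂ) ^ (-(w + 1)))) +
      K * (((x ^ (-1 : ℝ) : ℝ) : ℂ) * (x : ℂ) ^ (-(w + 1)))) (Set.Ioi 1) := j2.add j3
  refine ⟨j1.add j4, ?_⟩
  rw [integral_add j1 j4, integral_add j2 j3, integral_const_mul, integral_const_mul,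
    integral_const_mul, integral_sub i4 (i3.const_mul (c : ℂ)), integral_const_mul, e1, e2, e3, e4,
    oscillationTransform]
  push_cast
  rw [sub_zero, sub_neg_eq_add]
  ring

theorem analyticAt_oscillationTransform {κ : ℝ} (hκ : κ ≤ 3 / 2) (ε c τ K : ℝ) {t : ℝ}
    (ht : 3 / 2 - κ < t) : AnalyticAt ℂ (oscillationTransform κ ε c τ K) t := by
  have h1 : (t : ℂ) - (3 / 2 - κ) ≠ 0 := by
    have h := Complex.ofReal_ne_zero.mpr (sub_pos.mpr ht).ne'
    push_cast at h
    exact h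
  have h2 : (t : ℂ) ≠ 0 := Complex.ofReal_ne_zero.mpr (by linarith)
  have h3 : (t : ℂ) + 1 ≠ 0 := by exact_mod_cast (show t + 1 ≠ 0 by linarith)
  have h4 : (t : ℂ) + κ - 1 ≠ 0 := by exact_mod_cast (show t + κ - 1 ≠ 0 by linarith)
  have h5 : riemannZeta₁ ((t : ℂ) + κ - 1) ≠ 0 := by
    have := riemannZeta₁_ofReal_ne_zero (σ := t + κ - 1) (by linarith)
    simpa using this
  have hz : AnalyticAt ℂ (fun w : ℂ => riemannZeta₁ (w + κ - 1)) t :=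
    (differentiable_riemannZeta₁.comp
      ((differentiable_id.add_const (κ : ℂ)).sub_const 1)).analyticAt _
  unfold oscillationTransform
  refine ((analyticAt_const.div (analyticAt_id.sub analyticAt_const) h1).add
    (analyticAt_const.mul (((analyticAt_const.div analyticAt_id h2).mul (AnalyticAt.div ?_ (?_ :
      AnalyticAt ℂ (fun w : ℂ => (w + κ - 1) * riemannZeta₁ (w + κ - 1)) t)
      (mul_ne_zero h4 h5))).sub
      (analyticAt_const.div analyticAt_id h2)))).add
    (analyticAt_const.div (analyticAt_id.add analyticAt_const) h3)
  · fun_prop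
  · exact AnalyticAt.mul (by fun_prop) hz

open ProbabilityTheory in
/-- If `oscillationTest` is nonnegative, then its Mellin transform `L` converges for
`Re w > 3/2 - κ`, and there it satisfies the equation defining `oscillationTransform` after
multiplication by `w (w + κ - 1) ((w + κ - 2) ζ(w + κ - 1))`. -/
theorem exists_continuation_of_oscillationTest_nonneg {κ : ℝ} (hκ : κ ≤ 3 / 2) {ε c τ K : ℝ}
    (h0 : ∀ x > 1, 0 ≤ oscillationTest κ ε c τ K x) :
    ∃ L : ℂ → ℂ, (∀ w : ℂ, 3 / 2 - κ < w.re → ‖L w‖ ≤ ‖oscillationTransform κ ε c τ K w.re‖) ∧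
      ∀ w : ℂ, 3 / 2 - κ < w.re → (L w - ε / (w - (3 / 2 - κ)) - K / (w + 1) + τ * c / w) *
        (w * ((w + κ - 1) * riemannZeta₁ (w + κ - 1))) = τ * (w + κ - 1 - 1) := by
  set X : ℝ → ℝ := fun x => -Real.log x with hXdef
  set μ := mellinMeasure (oscillationTest κ ε c τ K) with hμ
  set G := oscillationTransform κ ε c τ K with hG
  have hm := aestronglyMeasurable_oscillationTest κ ε c τ K
  have hXm : AEMeasurable X μ := Real.measurable_log.neg.aemeasurable
  have hLG : ∀ w : ℂ, 2 + |κ| < w.re → complexMGF X μ w = G w := fun w hw => by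
    rw [hμ, hXdef, complexMGF_mellinMeasure hm h0, (integral_oscillationTest_mul_cpow κ ε c τ K hw).2]
  have hIb : Set.Ioi (2 + |κ|) ⊆ integrableExpSet X μ := fun t ht =>
    mem_integrableExpSet_mellinMeasure hm h0
      (integral_oscillationTest_mul_cpow κ ε c τ K (by simpa using ht)).1
  have hI : Set.Ioi (3 / 2 - κ) ⊆ integrableExpSet X μ :=
    Ioi_subset_integrableExpSet hXm (ae_mellinMeasure_neg_log_nonpos _)
      (fun t ht => analyticAt_oscillationTransform hκ ε c τ K ht) hIb
      fun t ht => hLG t (by simpa using ht)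
  have hint : Set.Ioi (3 / 2 - κ) ⊆ interior (integrableExpSet X μ) :=
    isOpen_Ioi.subset_interior_iff.mpr hI
  have hreal : Set.EqOn (fun t : ℝ => complexMGF X μ t) (fun t : ℝ => G t)
      (Set.Ioi (3 / 2 - κ)) := by
    refine AnalyticOnNhd.eqOn_of_preconnected_of_eventuallyEq
      (z₀ := 3 + |κ|) (fun t ht => (analyticAt_complexMGF ?_).along_ofReal)
      (fun t ht => (analyticAt_oscillationTransform hκ ε c τ K ht).along_ofReal) isPreconnected_Ioi ?_ ?_
    · rw [Complex.ofReal_re]; exact hint ht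
    · rw [Set.mem_Ioi]; linarith [neg_abs_le κ]
    · filter_upwards [Ioi_mem_nhds (show 2 + |κ| < 3 + |κ| by linarith)] with t ht
      exact hLG t (by simpa using ht)
  refine ⟨complexMGF X μ, fun w hw => ?_, fun w hw => ?_⟩
  -- Positivity of the measure enters here: the transform at w is dominated by its value at Re w.
  · have h1 : complexMGF X μ (w.re : ℂ) = G w.re := hreal hw
    rw [← h1, complexMGF_ofReal, Complex.norm_real, Real.norm_eq_abs]
    exact norm_complexMGF_le_mgf.trans (le_abs_self _)
  · have hopen : IsOpen {z : ℂ | 3 / 2 - κ < z.re} := isOpen_lt continuous_const Complex.continuous_re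
    have hne : ∀ z : ℂ, 3 / 2 - κ < z.re → z - (3 / 2 - κ) ≠ 0 ∧ z ≠ 0 ∧ z + 1 ≠ 0 := by
      intro z hz
      refine ⟨fun h => ?_, fun h => ?_, fun h => ?_⟩
      · have := congrArg Complex.re h; simp at this; linarith
      · rw [h] at hz; simp at hz; linarith
      · have := congrArg Complex.re h; simp at this; linarith
    -- With denominators cleared, both sides are holomorphic in the whole half-plane whatever the
    -- zeros of ζ, so the identity extends from the region of absolute convergence.
    refine AnalyticOnNhd.eqOn_of_preconnected_of_eventuallyEq (U := {z : ℂ | 3 / 2 - κ < z.re})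
      (z₀ := ((3 + |κ| : ℝ) : ℂ))
      (f := fun w => (complexMGF X μ w - ε / (w - (3 / 2 - κ)) - K / (w + 1) + τ * c / w) *
        (w * ((w + κ - 1) * riemannZeta₁ (w + κ - 1))))
      (g := fun w => τ * (w + κ - 1 - 1))
      (DifferentiableOn.analyticOnNhd (fun z hz => DifferentiableAt.differentiableWithinAt ?_)
        hopen)
      (DifferentiableOn.analyticOnNhd (by fun_prop) hopen)
      (convex_halfSpace_re_gt _).isPreconnected ?_ ?_ hw
    · obtain ⟨n1, n2, n3⟩ := hne z hz
      have hd := (analyticAt_complexMGF (hint hz)).differentiableAt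
      fun_prop (disch := assumption)
    · simp only [Set.mem_ofPred_eq, Complex.ofReal_re]
      linarith [neg_abs_le κ]
    · filter_upwards [(isOpen_lt continuous_const Complex.continuous_re).mem_nhds
        (show 2 + |κ| < ((3 + |κ| : ℝ) : ℂ).re by rw [Complex.ofReal_re]; linarith)] with z hz
      have hz' : 2 + |κ| < z.re := hz
      obtain ⟨n1, n2, n3⟩ := hne z (by linarith [neg_abs_le κ])
      have hs : 1 < (z + κ - 1).re := by simp; linarith [neg_abs_le κ]
      have n4 : z + κ - 1 ≠ 0 := fun h => by rw [h] at hs; simp at hs; linarith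
      have n5 : riemannZeta₁ (z + κ - 1) ≠ 0 := fun h => by
        have h1 : z + κ - 1 ≠ 1 := fun h => by rw [h] at hs; simp at hs
        refine riemannZeta_ne_zero_of_one_lt_re hs ?_
        rw [riemannZeta_eq_inv_sub_mul h1, h, mul_zero]
      rw [hLG z hz', hG, oscillationTransform]
      generalize riemannZeta₁ (z + κ - 1) = Z at *
      generalize z + (κ : ℂ) - 1 = S at *
      generalize z - (3 / 2 - (κ : ℂ)) = A at *
      have : (ε : ℂ) / A + τ * (1 / z * ((S - 1) / (S * Z)) - c / z) + K / (z + 1) - ε / A -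
          K / (z + 1) + τ * c / z = τ * (1 / z * ((S - 1) / (S * Z))) := by ring
      rw [this]
      field_simp

/-! ### Comparison of singularities -/

theorem tendsto_ofReal_nhdsGT_zero :
    Filter.Tendsto (fun δ : ℝ => (δ : ℂ)) (nhdsWithin 0 (Set.Ioi 0)) (nhdsWithin 0 {0}ᶜ) := by
  refine tendsto_nhdsWithin_iff.mpr
    ⟨(Complex.continuous_ofReal.tendsto' 0 0 Complex.ofReal_zero).mono_left nhdsWithin_le_nhds, ?_⟩
  filter_upwards [self_mem_nhdsWithin] with δ hδ
  exact Complex.ofReal_ne_zero.mpr (ne_of_gt hδ)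

theorem riemannZeta₁_one_half_ne_zero : riemannZeta₁ (1 / 2) ≠ 0 := by
  have := riemannZeta₁_ofReal_ne_zero (σ := 1 / 2) (by norm_num)
  simpa using this

open Filter Topology in
/-- The residue of `oscillationTransform` at its rightmost real pole. -/
theorem tendsto_mul_oscillationTransform {κ : ℝ} (hκ : κ ≤ 3 / 2) (ε : ℝ) {c : ℝ}
    (hc : κ = 3 / 2 → (c : ℂ) = 2 / riemannZeta (1 / 2)) (τ K : ℝ) :
    Tendsto (fun δ : ℝ => (δ : ℂ) * oscillationTransform κ ε c τ K ((3 / 2 - κ + δ : ℝ) : ℂ))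
      (𝓝[>] 0) (𝓝 ε) := by
  have hδ : Tendsto (fun δ : ℝ => (δ : ℂ)) (𝓝[>] 0) (𝓝 0) :=
    tendsto_ofReal_nhdsGT_zero.mono_right nhdsWithin_le_nhds
  have hs : Tendsto (fun δ : ℝ => (1 / 2 : ℂ) + δ) (𝓝[>] 0) (𝓝 (1 / 2)) := by
    simpa using hδ.const_add (1 / 2 : ℂ)
  have hw : Tendsto (fun δ : ℝ => (3 / 2 - κ : ℂ) + δ) (𝓝[>] 0) (𝓝 (3 / 2 - κ)) := by
    simpa using hδ.const_add (3 / 2 - κ : ℂ)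
  have hZ : Tendsto (fun δ : ℝ => riemannZeta₁ ((1 / 2 : ℂ) + δ)) (𝓝[>] 0)
      (𝓝 (riemannZeta₁ (1 / 2))) :=
    (differentiable_riemannZeta₁.continuous.tendsto _).comp hs
  have hQ : Tendsto (fun δ : ℝ => ((1 / 2 : ℂ) + δ - 1) / (((1 / 2 : ℂ) + δ) *
      riemannZeta₁ ((1 / 2 : ℂ) + δ)) - c) (𝓝[>] 0)
      (𝓝 ((1 / 2 - 1) / ((1 / 2) * riemannZeta₁ (1 / 2)) - c)) :=
    ((hs.sub_const 1).div (hs.mul hZ)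
      (mul_ne_zero (by norm_num) riemannZeta₁_one_half_ne_zero)).sub_const _
  have hR : Tendsto (fun δ : ℝ => (δ : ℂ) / ((3 / 2 - κ : ℂ) + δ) * (((1 / 2 : ℂ) + δ - 1) /
      (((1 / 2 : ℂ) + δ) * riemannZeta₁ ((1 / 2 : ℂ) + δ)) - c)) (𝓝[>] 0) (𝓝 0) := by
    -- For κ = 3/2 the factor δ/w equals 1, and the bracket must vanish in the limit, which is what
    -- fixes c. For κ < 3/2 the point 3/2 - κ is not 0 and any c works.
    rcases eq_or_ne κ (3 / 2) with h | h
    · have h0 : (1 / 2 - 1) / ((1 / 2) * riemannZeta₁ (1 / 2)) - (c : ℂ) = 0 := by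
        rw [hc h, riemannZeta_eq_inv_sub_mul (by norm_num : (1 / 2 : ℂ) ≠ 1)]
        have := riemannZeta₁_one_half_ne_zero
        field_simp
        ring
      rw [h0] at hQ
      refine hQ.congr' ?_
      filter_upwards [self_mem_nhdsWithin] with δ hδ0
      have h1 : (δ : ℂ) ≠ 0 := Complex.ofReal_ne_zero.mpr (ne_of_gt hδ0)
      rw [h]
      push_cast
      rw [sub_self, zero_add, div_self h1, one_mul]
    · have h1 : (3 / 2 - κ : ℂ) ≠ 0 := by
        have h2 := Complex.ofReal_ne_zero.mpr (sub_ne_zero.mpr h.symm)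
        push_cast at h2
        exact h2
      simpa using (hδ.div hw h1).mul hQ
  have hK : Tendsto (fun δ : ℝ => (δ : ℂ) * (K / ((3 / 2 - κ : ℂ) + δ + 1))) (𝓝[>] 0) (𝓝 0) := by
    have h1 : (3 / 2 - κ + 1 : ℂ) ≠ 0 := by
      have h2 := Complex.ofReal_ne_zero.mpr (show (3 / 2 - κ + 1 : ℝ) ≠ 0 by linarith)
      push_cast at h2
      exact h2
    simpa using hδ.mul ((tendsto_const_nhds (x := (K : ℂ))).div (hw.add_const 1) h1)
  have hsum := ((hR.const_mul (τ : ℂ)).const_add (ε : ℂ)).add hK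
  rw [mul_zero, add_zero, add_zero] at hsum
  refine hsum.congr' ?_
  filter_upwards [self_mem_nhdsWithin] with δ hδ0
  have h1 : (δ : ℂ) ≠ 0 := Complex.ofReal_ne_zero.mpr (ne_of_gt hδ0)
  have h2 : ((3 / 2 - κ + δ : ℝ) : ℂ) = 3 / 2 - κ + δ := by push_cast; rfl
  have h3 : (3 / 2 - κ + δ + κ - 1 : ℂ) = 1 / 2 + δ := by ring
  rw [h2, oscillationTransform, h3, add_sub_cancel_left]
  field_simp

open Filter Topology in
/-- One-sided oscillation of the primitive of `M(u) u^{-κ}` around `c`. -/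
theorem exists_frequently_mul_mertensPrimitive_lt {κ : ℝ} (hκ : κ ≤ 3 / 2) {c : ℝ}
    (hc : κ = 3 / 2 → (c : ℂ) = 2 / riemannZeta (1 / 2)) {τ : ℝ} (hτ : τ ≠ 0) :
    ∃ ε > 0, ∃ᶠ x in atTop, τ * (mertensPrimitive κ x - c) < -(ε * x ^ (3 / 2 - κ)) := by
  obtain ⟨ρ, hre, hρ1, hρ⟩ := exists_riemannZeta₁_eq_zero
  set D : ℂ → ℂ := fun z => z * riemannZeta₁ z with hD
  have hDd : Differentiable ℂ D := differentiable_id.mul differentiable_riemannZeta₁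
  have hDρ : D ρ = 0 := by simp only [hD, hρ, mul_zero]
  -- At a simple zero on the critical line the transform has a residue of modulus |τ|‖ρ - 1‖/B at ρ
  -- + 1 - κ. Taking B + 1 makes ε strictly smaller and also covers B = 0, a multiple zero.
  set B : ℝ := ‖ρ + 1 - κ‖ * ‖deriv D ρ‖ with hB
  have hB0 : 0 ≤ B := by positivity
  have hρ0 : 0 < |τ| * ‖ρ - 1‖ :=
    mul_pos (abs_pos.mpr hτ) (norm_pos_iff.mpr (sub_ne_zero.mpr hρ1))
  refine ⟨|τ| * ‖ρ - 1‖ / (B + 1), by positivity, ?_⟩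
  set ε := |τ| * ‖ρ - 1‖ / (B + 1) with hε
  have hεB : ε * B < |τ| * ‖ρ - 1‖ := by
    rw [hε, div_mul_eq_mul_div, div_lt_iff₀ (by positivity)]
    nlinarith
  have hε0 : 0 < ε := by positivity
  intro hcon
  obtain ⟨K, hK⟩ := exists_oscillationTest_nonneg hε0.le (hcon.mono fun x hx => not_lt.mp hx)
  obtain ⟨L, hLG, hL⟩ := exists_continuation_of_oscillationTest_nonneg hκ hK
  rcases hre.lt_or_eq with hlt | heq
  -- Off the critical line the continued identity evaluates at the zero itself to 0 = τ(ρ - 1).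
  · have h := hL (ρ + 1 - κ) (by simp; linarith)
    rw [show ρ + 1 - κ + κ - 1 = ρ by ring, hρ, mul_zero, mul_zero, mul_zero] at h
    have := mul_ne_zero (Complex.ofReal_ne_zero.mpr hτ) (sub_ne_zero.mpr hρ1)
    exact this h.symm
  · have him : ρ.im ≠ 0 := fun h0 => by
      refine riemannZeta₁_one_half_ne_zero ?_
      have : ρ = 1 / 2 := Complex.ext (by simp [← heq]) (by simp [h0])
      rw [← this, hρ]
    have hδ : Tendsto (fun δ : ℝ => (δ : ℂ)) (𝓝[>] 0) (𝓝 0) :=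
      tendsto_ofReal_nhdsGT_zero.mono_right nhdsWithin_le_nhds
    have hw : Tendsto (fun δ : ℝ => ρ + 1 - κ + δ) (𝓝[>] 0) (𝓝 (ρ + 1 - κ)) := by
      simpa using hδ.const_add (ρ + 1 - κ)
    -- As ρ is not real, the explicit real poles stay away from ρ + 1 - κ, and those terms vanish
    -- after multiplication by δ.
    have hne : ∀ r : ℝ, ρ + 1 - κ - r ≠ 0 := fun r h => by
      have := congrArg Complex.im h
      simp at this
      exact him this
    have hslope : Tendsto (fun δ : ℝ => (δ : ℂ)⁻¹ * D (ρ + δ)) (𝓝[>] 0) (𝓝 (deriv D ρ)) := by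
      have h := (hDd ρ).hasDerivAt.tendsto_slope_zero.comp tendsto_ofReal_nhdsGT_zero
      simpa [Function.comp_def, hDρ] using h
    have herr : Tendsto (fun δ : ℝ => (δ : ℂ) * (ε / (ρ + 1 - κ + δ - (3 / 2 - κ)) +
        K / (ρ + 1 - κ + δ + 1) - τ * c / (ρ + 1 - κ + δ))) (𝓝[>] 0) (𝓝 0) := by
      have h1 := hne (3 / 2 - κ)
      have h2 := hne (-1)
      have h3 := hne 0
      push_cast at h1 h2 h3
      rw [sub_neg_eq_add] at h2
      rw [sub_zero] at h3
      have h := hδ.mul ((((tendsto_const_nhds (x := (ε : ℂ))).div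
        (hw.sub_const (3 / 2 - κ : ℂ)) h1).add ((tendsto_const_nhds (x := (K : ℂ))).div
        (hw.add_const 1) h2)).sub ((tendsto_const_nhds (x := (τ * c : ℂ))).div hw h3))
      rwa [zero_mul] at h
    have hright := ((tendsto_mul_oscillationTransform hκ ε hc τ K).norm.add herr.norm).mul
      (hw.norm.mul hslope.norm)
    rw [norm_zero, add_zero, Complex.norm_real, Real.norm_of_nonneg hε0.le] at hright
    have hleft : Tendsto (fun δ : ℝ => |τ| * ‖ρ - 1 + δ‖) (𝓝[>] 0) (𝓝 (|τ| * ‖ρ - 1‖)) := by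
      have h := (hδ.const_add (ρ - 1)).norm.const_mul |τ|
      rwa [add_zero] at h
    refine absurd (le_of_tendsto_of_tendsto hleft hright ?_) (not_le.mpr hεB)
    filter_upwards [self_mem_nhdsWithin] with δ hδ0
    have hδ0' : (0 : ℝ) < δ := hδ0
    have hδ1 : (δ : ℂ) ≠ 0 := Complex.ofReal_ne_zero.mpr hδ0'.ne'
    have hwre : (ρ + 1 - κ + δ).re = 3 / 2 - κ + δ := by
      simp [← heq]; ring
    have hwlt : 3 / 2 - κ < (ρ + 1 - κ + δ).re := by rw [hwre]; linarith
    have hnorm := hLG _ hwlt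
    rw [hwre] at hnorm
    have hid := hL _ hwlt
    rw [show ρ + 1 - κ + δ + κ - 1 = ρ + δ by ring] at hid
    -- Inserting δ · δ⁻¹ pairs δ with the transform, giving at most ε in the limit, and δ⁻¹ with D,
    -- giving D'(ρ). The limit is |τ|‖ρ - 1‖ ≤ εB, without any division by D'(ρ).
    have hid2 : (τ : ℂ) * (ρ - 1 + δ) = ((δ : ℂ) * L (ρ + 1 - κ + δ) -
        δ * (ε / (ρ + 1 - κ + δ - (3 / 2 - κ)) + K / (ρ + 1 - κ + δ + 1) -
          τ * c / (ρ + 1 - κ + δ))) * ((ρ + 1 - κ + δ) * ((δ : ℂ)⁻¹ * D (ρ + δ))) := by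
      calc (τ : ℂ) * (ρ - 1 + δ) = τ * (ρ + δ - 1) := by ring
        _ = (δ * (δ : ℂ)⁻¹) * (τ * (ρ + δ - 1)) := by rw [mul_inv_cancel₀ hδ1, one_mul]
        _ = _ := by rw [← hid]; ring
    have hL' : ‖(δ : ℂ) * L (ρ + 1 - κ + δ)‖ ≤
        ‖(δ : ℂ) * oscillationTransform κ ε c τ K ((3 / 2 - κ + δ : ℝ) : ℂ)‖ := by
      rw [norm_mul, norm_mul]
      exact mul_le_mul_of_nonneg_left hnorm (norm_nonneg _)
    calc |τ| * ‖ρ - 1 + δ‖ = ‖(τ : ℂ) * (ρ - 1 + δ)‖ := by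
          rw [norm_mul, Complex.norm_real, Real.norm_eq_abs]
      _ ≤ _ := by
          rw [hid2, norm_mul, norm_mul (ρ + 1 - κ + δ)]
          exact mul_le_mul_of_nonneg_right ((norm_sub_le _ _).trans (by gcongr)) (by positivity)

/-! ### The oscillation theorem and the divergent integral -/

theorem isBigOmegaPlusMinus_integral_mertensM {κ : ℝ} (hκ : κ ≤ 3 / 2) :
    IsBigOmegaPlusMinus
      (fun x : ℝ =>
        (∫ u in (1 : ℝ)..x, mertensM u / u ^ κ) - (if κ = 3 / 2 then twoDivZetaHalf else 0))
      (fun x : ℝ => x ^ (3 / 2 - κ)) := by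
  have hc : κ = 3 / 2 → (((if κ = 3 / 2 then twoDivZetaHalf else 0 : ℝ)) : ℂ) =
      2 / riemannZeta (1 / 2) := fun h => by rw [if_pos h, twoDivZetaHalf_eq]
  constructor
  -- The sign τ = -1 produces large positive values, τ = 1 large negative ones.
  · obtain ⟨ε, hε, h⟩ := exists_frequently_mul_mertensPrimitive_lt hκ hc (neg_ne_zero.mpr one_ne_zero)
    refine ⟨ε, hε, h.mono fun x hx => ?_⟩
    rw [neg_one_mul, neg_lt_neg_iff] at hx
    exact hx
  · obtain ⟨ε, hε, h⟩ := exists_frequently_mul_mertensPrimitive_lt hκ hc one_ne_zero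
    refine ⟨ε, hε, h.mono fun x hx => ?_⟩
    rw [one_mul] at hx
    exact hx

open MeasureTheory Filter in
-- If the integral were finite, F - 2/ζ(1/2) would converge for κ = 3/2, yet it is infinitely often
-- above a positive constant and below a negative one.
theorem lintegral_abs_mertensM_div_rpow :
    ∫⁻ x in Set.Ioi (1 : ℝ), ENNReal.ofReal (|mertensM x| / x ^ (3 / 2 : ℝ)) = ⊤ := by
  by_contra hne
  have hint : IntegrableOn (fun u : ℝ => mertensM u / u ^ (3 / 2 : ℝ)) (Set.Ioi 1) := by
    refine ⟨(measurable_mertensM.div (measurable_id.pow_const _)).aestronglyMeasurable, ?_⟩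
    rw [hasFiniteIntegral_iff_norm]
    refine lt_of_eq_of_lt ?_ (lt_top_iff_ne_top.mpr hne)
    refine setLIntegral_congr_fun measurableSet_Ioi fun x hx => ?_
    have hx0 : (0 : ℝ) < x := zero_lt_one.trans hx
    rw [norm_div, Real.norm_eq_abs, Real.norm_of_nonneg (Real.rpow_nonneg hx0.le _)]
  have hlim := (intervalIntegral_tendsto_integral_Ioi 1 hint tendsto_id).sub_const twoDivZetaHalf
  obtain ⟨⟨c₁, hc₁, h₁⟩, ⟨c₂, hc₂, h₂⟩⟩ :=
    isBigOmegaPlusMinus_integral_mertensM (le_refl (3 / 2 : ℝ))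
  simp only [if_true, sub_self, Real.rpow_zero, mul_one] at h₁ h₂
  have hl₁ := ge_of_tendsto_of_frequently hlim (h₁.mono fun x hx => le_of_lt hx)
  have hl₂ := le_of_tendsto_of_frequently hlim (h₂.mono fun x hx => le_of_lt hx)
  linarith

theorem mainTheorem4 :
    (∀ κ : ℝ, κ ≤ 3 / 2 →
      IsBigOmegaPlusMinus
        (fun x : ℝ =>
          (∫ u in (1 : ℝ)..x, mertensM u / u ^ κ) - (if κ = 3 / 2 then twoDivZetaHalf else 0))
        (fun x : ℝ => x ^ (3 / 2 - κ))) ∧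
    ∫⁻ x in Set.Ioi (1 : ℝ), ENNReal.ofReal (|mertensM x| / x ^ (3 / 2 : ℝ)) = ⊤ :=
  ⟨fun _ hκ => isBigOmegaPlusMinus_integral_mertensM hκ, lintegral_abs_mertensM_div_rpow⟩
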